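/- Let $\mathfrak g$ be the two-dimensional complex Lie algebra with basis $\{a,b\}$ and $[a,b]=b$, and let $\mathfrak n=\langle b\rangle$. Let $\mathfrak W$ be the category of $\mathfrak g$-modules $M$ on which $\mathfrak n$ acts locally finitely, i.e. $\dim U(\mathfrak n)v<\infty$ for all $v\in M$ (Whittaker modules). Let $\sim$ be the smallest equivalence relation on isomorphism classes of simple finite-dimensional $\mathfrak n$-modules such that $L\sim S$ whenever $L$ and $S$ both occur as composition factors of some indecomposable finite-dimensional $\mathfrak n$-module, or $S$ is a subquotient of $(\mathfrak g/\mathfrak n)\otimes L$. Let $\mathfrak W(0)$ be the block of $\lambda=0$: the full subcategory of those $M\in\mathfrak W$ that are the sum of the images of all homomorphisms $U(\mathfrak g)\otimes_{U(\mathfrak n)}N\to M$, where $N$ runs over the finite-dimensional $\mathfrak n$-modules all of whose composition factors lie in the $\sim$-class of the trivial one-dimensional module. Let $\overline{\mathfrak W(0)}$ be the full subcategory of $\mathfrak W(0)$ of modules of finite length. For $\mu\in\mathbb C$ let $L(\mu)$ be the one-dimensional $\mathfrak g$-module on which $b$ acts by $0$ and $a$ by $\mu$. For $\xi\in\mathbb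 C/\mathbb Z$ let $\overline{\mathfrak W(0)}_\xi$ be the full subcategory of $\overline{\mathfrak W(0)}$ of modules all of whose simple subquotients are isomorphic to $L(\mu)$ with $\mu\in\xi$. Then: (i) $\overline{\mathfrak W(0)}\cong\bigoplus_{\xi\in\mathbb C/\mathbb Z}\overline{\mathfrak W(0)}_\xi$. That is, $(M_\xi)_\xi\mapsto\bigoplus_\xi M_\xi$ is an equivalence from the category of families of objects $M_\xi\in\overline{\mathfrak W(0)}_\xi$, almost all zero, to $\overline{\mathfrak W(0)}$. (ii) For each $\xi\in\mathbb C/\mathbb Z$, the category $\overline{\mathfrak W(0)}_\xi$ is equivalent, as a $\mathbb C$-linear category, to the category of finite-dimensional modules over the quiver with vertex set $\mathbb Z$, a loop $\mathtt a_i:i\to i$ and an arrow $\mathtt b_i:i\to i+1$ for every $i\in\mathbb Z$, with relations $\mathtt b_i\mathtt a_i=\mathtt a_{i+1}\mathtt b_i$ for all $i$, on which every $\mathtt a_i$ acts locally nilpotently. (Finite-dimensional means that the direct sum of the spaces at all vertices is finite dimensional.) -/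

import Mathlib

open CategoryTheory CategoryTheory.Limits
open scoped TensorProduct ModuleCat

universe u v w

namespace Whittaker

/-! ### Finite-dimensional modules over a complex Lie algebra -/

/-- A finite-dimensional module over the complex Lie algebra `L` (bundled). -/
structure FDLieMod (L : Type u) [LieRing L] [LieAlgebra ℂ L] where
  carrier : Type v
  [addCommGroup : AddCommGroup carrier]
  [module : Module ℂ carrier]
  [lieRingModule : LieRingModule L carrier]
  [lieModule : LieModule ℂ L carrier]
  [finite : Module.Finite ℂ carrier]

attribute [instance] FDLieMod.addCommGroup FDLieMod.module FDLieMod.lieRingModule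
  FDLieMod.lieModule FDLieMod.finite

section LieSide

variable {L : Type u} [LieRing L] [LieAlgebra ℂ L]

/-- `[M : S] ≠ 0`: the module `S` is isomorphic to a subquotient of `M`
(used for simple finite-dimensional `S`). -/
def HasFactor (M : Type v) [AddCommGroup M] [Module ℂ M] [LieRingModule L M] [LieModule ℂ L M]
    (S : Type w) [AddCommGroup S] [Module ℂ S] [LieRingModule L S] [LieModule ℂ L S] : Prop :=
  ∃ p q : LieSubmodule ℂ L M, p ≤ q ∧ Nonempty ((q ⧸ p.comap q.incl) ≃ₗ⁅ℂ,L⁆ S)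

/-- The module `M` is nonzero and is not a direct sum of two nonzero submodules. -/
def IsIndecomposable (M : Type v) [AddCommGroup M] [Module ℂ M] [LieRingModule L M]
    [LieModule ℂ L M] : Prop :=
  Nontrivial M ∧ ∀ p q : LieSubmodule ℂ L M, IsCompl p q → p = ⊥ ∨ q = ⊥

/-- `S` is the one-dimensional module on which `L` acts by the character `χ`. -/
def IsCharModule (χ : LieAlgebra.LieCharacter ℂ L) (S : Type v) [AddCommGroup S] [Module ℂ S]
    [LieRingModule L S] : Prop :=
  Module.finrank ℂ S = 1 ∧ ∀ (x : L) (s : S), ⁅x, s⁆ = χ x • s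

end LieSide

/-- Simple finite-dimensional modules over `L`. -/
abbrev IrrFD (L : Type u) [LieRing L] [LieAlgebra ℂ L] :=
  {S : FDLieMod.{u, v} L // LieModule.IsIrreducible ℂ L S.carrier}

section Blocks

variable {𝔤 : Type u} [LieRing 𝔤] [LieAlgebra ℂ 𝔤]

/-- The elementary relations generating the block equivalence relation on the (isomorphism classes
of) simple finite-dimensional `𝔫`-modules. -/
inductive Linked (𝔫 : LieSubalgebra ℂ 𝔤) : IrrFD.{u, v} 𝔫 → IrrFD.{u, v} 𝔫 → Prop
  | iso (S T : IrrFD.{u, v} 𝔫) (e : S.1.carrier ≃ₗ⁅ℂ,𝔫⁆ T.1.carrier) : Linked 𝔫 S T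
  | indec (S T : IrrFD.{u, v} 𝔫) (M : FDLieMod.{u, v} 𝔫)
      (hM : IsIndecomposable (L := 𝔫) M.carrier)
      (hS : HasFactor (L := 𝔫) M.carrier S.1.carrier)
      (hT : HasFactor (L := 𝔫) M.carrier T.1.carrier) : Linked 𝔫 S T
  | tensor (S T : IrrFD.{u, v} 𝔫)
      (h : HasFactor (L := 𝔫) ((𝔤 ⧸ 𝔫.toLieSubmodule) ⊗[ℂ] S.1.carrier) T.1.carrier) :
      Linked 𝔫 S T

/-- The block equivalence relation on simple finite-dimensional `𝔫`-modules. -/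
def BlockRel (𝔫 : LieSubalgebra ℂ 𝔤) : IrrFD.{u, v} 𝔫 → IrrFD.{u, v} 𝔫 → Prop :=
  Relation.EqvGen (Linked 𝔫)

/-- `S` lies in the block equivalence class of the one-dimensional module given by the
character `χ` of `𝔫`. -/
def InClass (𝔫 : LieSubalgebra ℂ 𝔤) (χ : LieAlgebra.LieCharacter ℂ 𝔫) (S : IrrFD.{u, v} 𝔫) :
    Prop :=
  ∃ T : IrrFD.{u, v} 𝔫, IsCharModule χ T.1.carrier ∧ BlockRel 𝔫 T S

attribute [local instance] LieRing.ofAssociativeRing in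
/-- The algebra homomorphism `U(𝔫) → U(𝔤)` induced by the inclusion. -/
noncomputable def envIncl (𝔫 : LieSubalgebra ℂ 𝔤) :
    UniversalEnvelopingAlgebra ℂ 𝔫 →ₐ[ℂ] UniversalEnvelopingAlgebra ℂ 𝔤 :=
  UniversalEnvelopingAlgebra.lift ℂ ((UniversalEnvelopingAlgebra.ι ℂ).comp 𝔫.incl)

/-- The relations `u x ⊗ m = u ⊗ x m` (for `u ∈ U(𝔤)`, `x ∈ 𝔫`, `m ∈ N`) that turn
`U(𝔤) ⊗_ℂ N` into `U(𝔤) ⊗_{U(𝔫)} N`. -/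
noncomputable def indRel (𝔫 : LieSubalgebra ℂ 𝔤) (N : Type v) [AddCommGroup N] [Module ℂ N]
    [LieRingModule 𝔫 N] :
    Submodule (UniversalEnvelopingAlgebra ℂ 𝔤) (UniversalEnvelopingAlgebra ℂ 𝔤 ⊗[ℂ] N) :=
  Submodule.span _
    {t | ∃ (y : UniversalEnvelopingAlgebra ℂ 𝔤) (x : 𝔫) (m : N),
      t = (y * UniversalEnvelopingAlgebra.ι ℂ (x : 𝔤)) ⊗ₜ[ℂ] m - y ⊗ₜ[ℂ] ⁅x, m⁆}

/-- The induced module `Ind N = U(𝔤) ⊗_{U(𝔫)} N`. -/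
abbrev Ind (𝔫 : LieSubalgebra ℂ 𝔤) (N : Type v) [AddCommGroup N] [Module ℂ N]
    [LieRingModule 𝔫 N] :=
  (UniversalEnvelopingAlgebra ℂ 𝔤 ⊗[ℂ] N) ⧸ indRel 𝔫 N

/-- The category of `𝔤`-modules, as modules over `U(𝔤)`. -/
abbrev GMod (𝔤 : Type u) [LieRing 𝔤] [LieAlgebra ℂ 𝔤] :=
  ModuleCat.{v} (UniversalEnvelopingAlgebra ℂ 𝔤)

/-- The subspace `U(𝔫) m` of a `𝔤`-module. -/
noncomputable def orbit (𝔫 : LieSubalgebra ℂ 𝔤) (M : GMod.{u, v} 𝔤) (m : M) : Submodule ℂ M :=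
  LinearMap.range
    (((LinearMap.toSpanSingleton (UniversalEnvelopingAlgebra ℂ 𝔤) M m).restrictScalars ℂ) ∘ₗ
      (envIncl 𝔫).toLinearMap)

/-- The category `𝔚` of `𝔤`-modules on which the action of `𝔫` is locally finite. -/
def locallyFinite (𝔫 : LieSubalgebra ℂ 𝔤) : ObjectProperty (GMod.{u, v} 𝔤) :=
  fun M => ∀ m : M, Module.Finite ℂ (orbit 𝔫 M m)

/-- The trace in `M` of all modules `Ind N`, where `N` is a finite-dimensional `𝔫`-module all of
whose simple subquotients lie in the class of `χ`. -/
noncomputable def blockTrace (𝔫 : LieSubalgebra ℂ 𝔤) (χ : LieAlgebra.LieCharacter ℂ 𝔫)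
    (M : GMod.{u, v} 𝔤) : Submodule (UniversalEnvelopingAlgebra ℂ 𝔤) M :=
  ⨆ (N : FDLieMod.{u, v} 𝔫)
    (_ : ∀ S : IrrFD.{u, v} 𝔫,
      HasFactor (L := 𝔫) N.carrier S.1.carrier → InClass.{u, v} 𝔫 χ S)
    (f : Ind 𝔫 N.carrier →ₗ[UniversalEnvelopingAlgebra ℂ 𝔤] M), LinearMap.range f

/-- The block `𝔚(χ)`. -/
def block (𝔫 : LieSubalgebra ℂ 𝔤) (χ : LieAlgebra.LieCharacter ℂ 𝔫) :
    ObjectProperty (GMod.{u, v} 𝔤) :=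
  fun M => locallyFinite 𝔫 M ∧ blockTrace 𝔫 χ M = ⊤

/-- The modules of finite length in the block `𝔚(χ)`. -/
def finBlock (𝔫 : LieSubalgebra ℂ 𝔤) (χ : LieAlgebra.LieCharacter ℂ 𝔫) :
    ObjectProperty (GMod.{u, v} 𝔤) :=
  fun M => block 𝔫 χ M ∧ IsFiniteLength (UniversalEnvelopingAlgebra ℂ 𝔤) M

end Blocks

/-! ### The decomposition over `ℂ / ℤ` -/

section Summands

variable {𝔤 : Type u} [LieRing 𝔤] [LieAlgebra ℂ 𝔤]

/-- `X` is (isomorphic to) the one-dimensional `𝔤`-module `L(μ)`, on which `b` acts by `0` and `a`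
acts by `μ`. -/
def IsL (a b : 𝔤) (μ : ℂ) (X : Type v) [AddCommGroup X] [Module ℂ X]
    [Module (UniversalEnvelopingAlgebra ℂ 𝔤) X] : Prop :=
  Module.finrank ℂ X = 1 ∧ ∀ x : X,
    UniversalEnvelopingAlgebra.ι ℂ b • x = 0 ∧ UniversalEnvelopingAlgebra.ι ℂ a • x = μ • x

/-- The group `ℂ / ℤ`. -/
abbrev CModZ := ℂ ⧸ AddSubgroup.zmultiples (1 : ℂ)

/-- The modules in the finite-length block `𝔚(χ)` all of whose simple subquotients are of the form
`L(μ)` with `μ ∈ ξ`. -/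
def finBlockAt (𝔫 : LieSubalgebra ℂ 𝔤) (χ : LieAlgebra.LieCharacter ℂ 𝔫) (a b : 𝔤) (ξ : CModZ) :
    ObjectProperty (GMod.{u, v} 𝔤) :=
  fun M => finBlock 𝔫 χ M ∧
    ∀ p q : Submodule (UniversalEnvelopingAlgebra ℂ 𝔤) M, p ≤ q →
      IsSimpleModule (UniversalEnvelopingAlgebra ℂ 𝔤) (q ⧸ p.comap q.subtype) →
      ∃ μ : ℂ, (μ : CModZ) = ξ ∧ IsL a b μ (q ⧸ p.comap q.subtype)

theorem finBlockAt_le (𝔫 : LieSubalgebra ℂ 𝔤) (χ : LieAlgebra.LieCharacter ℂ 𝔫) (a b : 𝔤)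
    (ξ : CModZ) : finBlockAt.{u, v} 𝔫 χ a b ξ ≤ finBlock 𝔫 χ :=
  fun _ h => h.1

end Summands

/-- The direct sum `⨁ i, C i` of categories: families of objects almost all of which are zero. -/
abbrev DirectSumCat {ι : Type*} (C : ι → Type*) [∀ i, Category (C i)] :=
  ObjectProperty.FullSubcategory (fun X : ∀ i, C i => {i | ¬ IsZero (X i)}.Finite)

/-- The `i`-th component functor of a direct sum of categories. -/
abbrev DirectSumCat.proj {ι : Type*} (C : ι → Type*) [∀ i, Category (C i)] (i : ι) :
    DirectSumCat C ⥤ C i :=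
  ObjectProperty.ι _ ⋙ Pi.eval C i

/-! ### Modules over the quiver -/

/-- A module over the quiver with vertices `i ∈ ℤ`, loops `a i : i → i` and arrows
`b i : i → i + 1`, subject to the relations `b i * a i = a (i + 1) * b i`. -/
structure QuiverMod where
  V : ℤ → Type v
  [addCommGroup : ∀ i, AddCommGroup (V i)]
  [module : ∀ i, Module ℂ (V i)]
  a : ∀ i, V i →ₗ[ℂ] V i
  b : ∀ i, V i →ₗ[ℂ] V (i + 1)
  comm : ∀ i, b i ∘ₗ a i = a (i + 1) ∘ₗ b i

namespace QuiverMod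

attribute [instance] QuiverMod.addCommGroup QuiverMod.module

/-- The space of homomorphisms: families of linear maps that commute with the arrows. -/
def homs (X Y : QuiverMod.{v}) : Submodule ℂ (∀ i, X.V i →ₗ[ℂ] Y.V i) where
  carrier := {f | (∀ i, f i ∘ₗ X.a i = Y.a i ∘ₗ f i) ∧ ∀ i, f (i + 1) ∘ₗ X.b i = Y.b i ∘ₗ f i}
  add_mem' {f g} hf hg :=
    ⟨fun i => by simp [LinearMap.add_comp, LinearMap.comp_add, hf.1 i, hg.1 i],
      fun i => by simp [LinearMap.add_comp, LinearMap.comp_add, hf.2 i, hg.2 i]⟩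
  zero_mem' := ⟨fun i => by simp, fun i => by simp⟩
  smul_mem' c {f} hf :=
    ⟨fun i => by simp [LinearMap.smul_comp, LinearMap.comp_smul, hf.1 i],
      fun i => by simp [LinearMap.smul_comp, LinearMap.comp_smul, hf.2 i]⟩

instance : Category QuiverMod.{v} where
  Hom X Y := homs X Y
  id X := ⟨fun _ => LinearMap.id, fun _ => rfl, fun _ => rfl⟩
  comp f g := ⟨fun i => g.1 i ∘ₗ f.1 i,
    fun i => by
      rw [LinearMap.comp_assoc, f.2.1 i, ← LinearMap.comp_assoc, g.2.1 i, LinearMap.comp_assoc],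
    fun i => by
      rw [LinearMap.comp_assoc, f.2.2 i, ← LinearMap.comp_assoc, g.2.2 i, LinearMap.comp_assoc]⟩

instance : Preadditive QuiverMod.{v} where
  homGroup X Y := inferInstanceAs (AddCommGroup (homs X Y))
  add_comp _ _ _ _ _ _ := Subtype.ext (funext fun _ => LinearMap.comp_add _ _ _)
  comp_add _ _ _ _ _ _ := Subtype.ext (funext fun _ => LinearMap.add_comp _ _ _)

instance : Linear ℂ QuiverMod.{v} where
  homModule X Y := inferInstanceAs (Module ℂ (homs X Y))
  smul_comp _ _ _ _ _ _ := Subtype.ext (funext fun _ => LinearMap.comp_smul _ _ _)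
  comp_smul _ _ _ _ _ _ := Subtype.ext (funext fun _ => LinearMap.smul_comp _ _ _)

/-- The module is finite dimensional (its total space `⨁ i, V i` is), and every `a i` acts locally
nilpotently. -/
def finNilp : ObjectProperty QuiverMod.{v} :=
  fun X => ((∀ i, Module.Finite ℂ (X.V i)) ∧ {i | Nontrivial (X.V i)}.Finite) ∧
    ∀ i (x : X.V i), ∃ k : ℕ, (X.a i ^ k) x = 0

end QuiverMod

end Whittaker

/-!
The relation `∼` preserves the weight of a simple `𝔫`-module: indecomposable modules have only one
generalized weight, and `𝔫` acts trivially on `𝔤 / 𝔫`. So, by Frobenius reciprocity, `b` acts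
locally nilpotently on the modules in `𝔚(0)`. On a simple one `b` vanishes, so it is some `L(μ)`;
hence finite length means finite dimension. Conversely `[a, b] = b` forces `b` to be nilpotent on
every finite-dimensional module, which therefore lies in `𝔚(0)`.

The same relation says that `b` shifts the generalized eigenvalues of `a` by one. The sum of the
generalized eigenspaces of `a` over a coset `ξ` of `ℤ` is therefore a submodule, which gives the
decomposition over `ℂ / ℤ`. In the summand of `μ + ℤ`, the generalized eigenspaces for `μ + i`, with
the nilpotent operators `a - (μ + i)` and the maps `b` between them, form the quiver module.
-/

namespace Whittaker

/-! ### Linear algebra -/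

section Intertwining

variable {R M N : Type*} [CommRing R] [AddCommGroup M] [Module R M] [AddCommGroup N] [Module R N]
  {A : Module.End R M} {A' : Module.End R N} {f : M →ₗ[R] N}

theorem map_mem_maxGenEigenspace_of_shift {μ ν : R}
    (h : ∀ m, A' (f m) = f (A m) + (ν - μ) • f m) {m : M} (hm : m ∈ A.maxGenEigenspace μ) :
    f m ∈ A'.maxGenEigenspace ν := by
  rw [Module.End.mem_maxGenEigenspace] at *
  obtain ⟨k, hk⟩ := hm
  have hcomm : (A' - ν • 1) ∘ₗ f = f ∘ₗ (A - μ • 1) := LinearMap.ext fun m => by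
    simp only [LinearMap.comp_apply, LinearMap.sub_apply, LinearMap.smul_apply,
      Module.End.one_apply, h, map_sub, map_smul]
    module
  have hpow := LinearMap.congr_fun (Module.End.commute_pow_left_of_commute hcomm k) m
  exact ⟨k, by rw [← LinearMap.comp_apply, hpow, LinearMap.comp_apply, hk, map_zero]⟩

theorem map_mem_maxGenEigenspace {μ : R} (h : ∀ m, A' (f m) = f (A m)) {m : M}
    (hm : m ∈ A.maxGenEigenspace μ) : f m ∈ A'.maxGenEigenspace μ :=
  map_mem_maxGenEigenspace_of_shift (fun m => by rw [h, sub_self, zero_smul, add_zero]) hm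

theorem map_mem_maxGenEigenspace_iff (hf : Function.Injective f) (h : ∀ m, A' (f m) = f (A m))
    {μ : R} {m : M} : f m ∈ A'.maxGenEigenspace μ ↔ m ∈ A.maxGenEigenspace μ := by
  refine ⟨fun hm => ?_, map_mem_maxGenEigenspace h⟩
  rw [Module.End.mem_maxGenEigenspace] at *
  obtain ⟨k, hk⟩ := hm
  have hcomm : (A' - μ • 1) ∘ₗ f = f ∘ₗ (A - μ • 1) := LinearMap.ext fun m => by simp [h]
  have hpow := LinearMap.congr_fun (Module.End.commute_pow_left_of_commute hcomm k) m
  exact ⟨k, hf (hpow.symm.trans (hk.trans (map_zero f).symm))⟩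

theorem maxGenEigenspace_eq_top_of_injective (hf : Function.Injective f)
    (h : ∀ m, A' (f m) = f (A m)) {μ : R} (hμ : A'.maxGenEigenspace μ = ⊤) :
    A.maxGenEigenspace μ = ⊤ :=
  eq_top_iff.2 fun _ _ => (map_mem_maxGenEigenspace_iff hf h).1 (hμ ▸ Submodule.mem_top)

theorem maxGenEigenspace_eq_top_of_surjective (hf : Function.Surjective f)
    (h : ∀ m, A' (f m) = f (A m)) {μ : R} (hμ : A.maxGenEigenspace μ = ⊤) :
    A'.maxGenEigenspace μ = ⊤ :=
  eq_top_iff.2 <| hf.forall.2 fun _ _ => map_mem_maxGenEigenspace h (hμ ▸ Submodule.mem_top)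

theorem mem_maxGenEigenspace_zero {m : M} :
    m ∈ A.maxGenEigenspace 0 ↔ ∃ k : ℕ, (A ^ k) m = 0 := by
  rw [Module.End.mem_maxGenEigenspace, zero_smul, sub_zero]

theorem hasEigenvalue_of_injective (hf : Function.Injective f) (h : ∀ m, A' (f m) = f (A m))
    {μ : R} (hμ : A.HasEigenvalue μ) : A'.HasEigenvalue μ := by
  obtain ⟨v, hv⟩ := hμ.exists_hasEigenvector
  refine Module.End.hasEigenvalue_of_hasEigenvector (x := f v)
    ⟨Module.End.mem_eigenspace_iff.2 ?_, (map_ne_zero_iff f hf).2 hv.2⟩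
  rw [h, hv.apply_eq_smul, map_smul]

end Intertwining

section Eigenvalues

variable {K V : Type*} [Field K] [AddCommGroup V] [Module K V] {f : Module.End K V}

theorem hasEigenvalue_of_surjective [FiniteDimensional K V] {W : Type*} [AddCommGroup W]
    [Module K W] {f' : Module.End K W} {p : V →ₗ[K] W} (hp : Function.Surjective p)
    (h : ∀ v, f' (p v) = p (f v)) {μ : K} (hμ : f'.HasEigenvalue μ) : f.HasEigenvalue μ := by
  have := Module.Finite.of_surjective p hp
  rw [Module.End.hasEigenvalue_iff_mem_spectrum, spectrum.mem_iff] at *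
  refine mt (fun hu => ?_) hμ
  rw [Module.End.isUnit_iff] at *
  have hcomm : (algebraMap K (Module.End K W) μ - f') ∘ₗ p =
      p ∘ₗ (algebraMap K (Module.End K V) μ - f) := LinearMap.ext fun v => by simp [h]
  have hsurj : Function.Surjective (algebraMap K (Module.End K W) μ - f') := by
    refine Function.Surjective.of_comp (g := p) ?_
    rw [← LinearMap.coe_comp, hcomm]
    exact hp.comp hu.2
  exact ⟨LinearMap.injective_iff_surjective.2 hsurj, hsurj⟩

theorem maxGenEigenspace_eq_bot {μ : K} (h : ¬ f.HasEigenvalue μ) : f.maxGenEigenspace μ = ⊥ := by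
  by_contra hne
  have htop : f.HasUnifEigenvalue μ ⊤ := hne
  exact h (htop.lt zero_lt_one)

theorem iSup_maxGenEigenspace_eq_top_of_forall_mem [IsAlgClosed K] [FiniteDimensional K V]
    {s : Set K} (hs : ∀ μ, f.HasEigenvalue μ → μ ∈ s) :
    ⨆ μ ∈ s, f.maxGenEigenspace μ = ⊤ := by
  refine top_unique (f.iSup_maxGenEigenspace_eq_top.ge.trans (iSup_le fun μ => ?_))
  by_cases hμ : f.HasEigenvalue μ
  · exact le_iSup₂_of_le μ (hs μ hμ) le_rfl
  · rw [maxGenEigenspace_eq_bot hμ]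
    exact bot_le

end Eigenvalues

theorem mul_pow_sub_pow_mul_of_mul_sub_mul_eq {A : Type*} [Ring A] {a b : A}
    (h : a * b - b * a = b) (k : ℕ) : a * b ^ k - b ^ k * a = k * b ^ k := by
  induction k with
  | zero => simp
  | succ k ih =>
    have hleib : a * b ^ (k + 1) - b ^ (k + 1) * a =
        (a * b ^ k - b ^ k * a) * b + b ^ k * (a * b - b * a) := by noncomm_ring
    rw [hleib, ih, h, mul_assoc, ← pow_succ, Nat.cast_succ, add_mul, one_mul]

-- Otherwise the powers of `b` are eigenvectors of `ad a` with infinitely many eigenvalues.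
theorem isNilpotent_of_mul_sub_mul_eq (K : Type*) {A : Type*} [Field K] [CharZero K] [Ring A]
    [Algebra K A] [FiniteDimensional K A] {a b : A} (h : a * b - b * a = b) : IsNilpotent b := by
  let ad : Module.End K A := LinearMap.mulLeft K a - LinearMap.mulRight K a
  have had : ∀ k : ℕ, ad (b ^ k) = (k : K) • b ^ k := fun k => by
    rw [Nat.cast_smul_eq_nsmul, nsmul_eq_mul, ← mul_pow_sub_pow_mul_of_mul_sub_mul_eq h]
    rfl
  by_contra hb
  refine Set.infinite_of_injective_forall_mem Nat.cast_injective (fun k : ℕ => ?_)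
    ad.finite_hasEigenvalue
  exact Module.End.hasEigenvalue_of_hasEigenvector (x := b ^ k)
    ⟨Module.End.mem_eigenspace_iff.2 (had k), fun h0 => hb ⟨k, h0⟩⟩

section Simple

variable {K : Type*} [Field K] [IsAlgClosed K]

-- By Zariski's lemma the residue field of the annihilator of a generator is a finite extension.
theorem finrank_eq_one_of_isSimpleModule (A M : Type*) [CommRing A] [Algebra K A]
    [Algebra.FiniteType K A] [AddCommGroup M] [Module K M] [Module A M] [IsScalarTower K A M]
    [IsSimpleModule A M] : Module.finrank K M = 1 := by
  obtain ⟨I, hI, ⟨e⟩⟩ := isSimpleModule_iff_quot_maximal.1 ‹IsSimpleModule A M›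
  let := Ideal.Quotient.field I
  have : Module.Finite K (A ⧸ I) := finite_of_finite_type_of_isJacobsonRing K (A ⧸ I)
  have hbij : Function.Bijective (algebraMap K (A ⧸ I)) :=
    IsAlgClosed.algebraMap_bijective_of_isIntegral
  rw [(e.restrictScalars K).finrank_eq,
    ← (LinearEquiv.ofBijective (Algebra.linearMap K (A ⧸ I)) hbij).finrank_eq,
    Module.finrank_self]

theorem finrank_eq_one_of_forall_invtSubmodule {V : Type*} [AddCommGroup V] [Module K V]
    [Nontrivial V] (f : Module.End K V)
    (h : ∀ W ∈ f.invtSubmodule, W = ⊥ ∨ W = ⊤) : Module.finrank K V = 1 := by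
  have : Nontrivial (Algebra.lsmul K K V f).invtSubmodule :=
    ⟨⟨⊥, ⊤, fun h => bot_ne_top (congrArg Subtype.val h)⟩⟩
  have : IsSimpleOrder (Algebra.lsmul K K V f).invtSubmodule :=
    ⟨fun W => (h W W.2).imp (fun h => Subtype.ext h) fun h => Subtype.ext h⟩
  have : IsSimpleModule (Polynomial K) (Module.AEval' f) :=
    (isSimpleModule_iff _ _).2 ((Module.AEval.mapSubmodule K V f).symm.isSimpleOrder)
  rw [(Module.AEval'.of f).finrank_eq]
  exact finrank_eq_one_of_isSimpleModule (Polynomial K) (Module.AEval' f)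

end Simple

/-! ### Blocks of finite-dimensional modules over a nilpotent Lie algebra -/

section GenWeightSpace

open LieModule

variable {R L M N : Type*} [CommRing R] [LieRing L] [LieAlgebra R L] [LieRing.IsNilpotent L]
  [AddCommGroup M] [Module R M] [LieRingModule L M] [LieModule R L M]
  [AddCommGroup N] [Module R N] [LieRingModule L N] [LieModule R L N] {χ : L → R}

theorem genWeightSpace_eq_top_of_injective {f : M →ₗ⁅R,L⁆ N} (hf : Function.Injective f)
    (h : genWeightSpace N χ = ⊤) : genWeightSpace M χ = ⊤ := by
  rw [← comap_genWeightSpace_eq_of_injective hf, h]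
  rfl

theorem genWeightSpace_eq_top_of_surjective {f : M →ₗ⁅R,L⁆ N} (hf : Function.Surjective f)
    (h : genWeightSpace M χ = ⊤) : genWeightSpace N χ = ⊤ := by
  have hmap := map_genWeightSpace_le (χ := χ) f
  rwa [h, f.map_top, (LieModuleHom.range_eq_top f).2 hf, top_le_iff] at hmap

theorem eq_of_genWeightSpace_eq_top [IsDomain R] [Module.IsTorsionFree R M] [Nontrivial M]
    {χ' : L → R} (h : genWeightSpace M χ = ⊤) (h' : genWeightSpace M χ' = ⊤) : χ = χ' := by
  by_contra hne
  have hdisj := disjoint_genWeightSpace R L M hne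
  rw [h, h', disjoint_self] at hdisj
  exact top_ne_bot ((LieSubmodule.toSubmodule_inj _ _).2 hdisj)

end GenWeightSpace

theorem isIrreducible_of_isAtom {R L M : Type*} [CommRing R] [LieRing L] [AddCommGroup M]
    [Module R M] [LieRingModule L M] {W : LieSubmodule R L M} (hW : IsAtom W) :
    LieModule.IsIrreducible R L W := by
  have : Nontrivial W := (LieSubmodule.nontrivial_iff_ne_bot R L M).2 hW.1
  refine LieModule.IsIrreducible.mk fun P hP => not_lt_top_iff.1 fun hlt => hP ?_
  have hmap := hW.2 _ (LieSubmodule.map_incl_lt_iff_lt_top.2 hlt)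
  rw [← LieSubmodule.map_bot (f := W.incl)] at hmap
  exact LieSubmodule.map_injective_of_injective W.injective_incl hmap

section LieModules

open LieModule

variable {L : Type*} [LieRing L] [LieAlgebra ℂ L]
  {M : Type*} [AddCommGroup M] [Module ℂ M] [LieRingModule L M] [LieModule ℂ L M]
  {S : Type*} [AddCommGroup S] [Module ℂ S] [LieRingModule L S] [LieModule ℂ L S]

theorem hasFactor_lieSubmodule (W : LieSubmodule ℂ L M) : HasFactor (L := L) M W := by
  have hbot : ((⊥ : LieSubmodule ℂ L M).comap W.incl).toSubmodule = ⊥ :=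
    (Submodule.eq_bot_iff _).2 fun m hm => Subtype.ext hm
  refine ⟨⊥, W, bot_le, ⟨{ Submodule.quotEquivOfEqBot _ hbot with map_lie' := ?_ }⟩⟩
  intro x m
  obtain ⟨m, rfl⟩ := LieSubmodule.Quotient.surjective_mk' _ m
  rfl

attribute [local instance] LieRing.ofAssociativeRing in
theorem exists_isCharModule [LieAlgebra.IsSolvable L] [Module.Finite ℂ S]
    (hS : LieModule.IsIrreducible ℂ L S) :
    ∃ χ : LieAlgebra.LieCharacter ℂ L, IsCharModule χ S := by
  have := nontrivial_of_isIrreducible ℂ L S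
  obtain ⟨χ, hχ⟩ := exists_nontrivial_weightSpace_of_isSolvable ℂ L S
  have hact : ∀ (x : L) (s : S), ⁅x, s⁆ = χ x • s := fun x s =>
    (mem_weightSpace χ s).1 ((weightSpace S χ).eq_top_of_isIrreducible ▸ LieSubmodule.mem_top s) x
  have hsimple : IsSimpleModule ℂ S := (isSimpleModule_iff _ _).2 <|
    { eq_bot_or_eq_top := fun W => by
        let P : LieSubmodule ℂ L S :=
          { W with lie_mem := fun {x s} hs => by rw [hact]; exact W.smul_mem _ hs }
        exact (hS.eq_bot_or_eq_top P).imp (congrArg LieSubmodule.toSubmodule)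
          (congrArg LieSubmodule.toSubmodule) }
  obtain ⟨s, hs⟩ := exists_ne (0 : S)
  have hlie : ∀ x y : L, χ ⁅x, y⁆ = 0 := fun x y => by
    have h := lie_lie x y s
    simp only [hact, smul_smul, mul_comm (χ x), sub_self] at h
    exact (smul_eq_zero.1 h).resolve_right hs
  refine ⟨{ χ with map_lie' := fun {x y} => (hlie x y).trans ?_ },
    isSimpleModule_iff_finrank_eq_one.1 hsimple, hact⟩
  rw [LieRing.of_associative_ring_bracket, mul_comm, sub_self]

section Nilpotent

variable [LieRing.IsNilpotent L] {χ : L → ℂ}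

theorem genWeightSpace_eq_top_of_forall_lie_eq_smul (h : ∀ (x : L) (m : M), ⁅x, m⁆ = χ x • m) :
    genWeightSpace M χ = ⊤ :=
  eq_top_iff.2 fun m _ => weightSpace_le_genWeightSpace M χ
    ((mem_weightSpace χ m).2 fun x => h x m)

theorem HasFactor.genWeightSpace_eq_top (h : HasFactor (L := L) M S)
    (hM : genWeightSpace M χ = ⊤) : genWeightSpace S χ = ⊤ := by
  obtain ⟨p, q, -, ⟨e⟩⟩ := h
  exact genWeightSpace_eq_top_of_surjective (f := e.toLieModuleHom) e.surjective
    (genWeightSpace_eq_top_of_surjective (LieSubmodule.Quotient.surjective_mk' (p.comap q.incl))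
      (genWeightSpace_eq_top_of_injective q.injective_incl hM))

theorem isCharModule_of_genWeightSpace_eq_top [Module.Finite ℂ S]
    (hS : LieModule.IsIrreducible ℂ L S) {χ : LieAlgebra.LieCharacter ℂ L}
    (h : genWeightSpace S χ = ⊤) : IsCharModule χ S := by
  have := nontrivial_of_isIrreducible ℂ L S
  obtain ⟨χ', hχ'⟩ := exists_isCharModule hS
  have := eq_of_genWeightSpace_eq_top h (genWeightSpace_eq_top_of_forall_lie_eq_smul hχ'.2)
  rwa [DFunLike.coe_injective this]

theorem IsIndecomposable.exists_genWeightSpace_eq_top [Module.Finite ℂ M]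
    (hM : IsIndecomposable (L := L) M) : ∃ χ : L → ℂ, genWeightSpace M χ = ⊤ := by
  obtain ⟨hnt, hM⟩ := hM
  obtain ⟨χ, hχ⟩ : ∃ χ : L → ℂ, genWeightSpace M χ ≠ ⊥ := by
    by_contra! h
    have htop := iSup_genWeightSpace_eq_top ℂ L M
    simp only [h, iSup_bot] at htop
    exact bot_ne_top ((LieSubmodule.toSubmodule_inj _ _).2 htop)
  have hcompl : IsCompl (genWeightSpace M χ) (⨆ χ' ≠ χ, genWeightSpace M χ') :=
    ⟨iSupIndep_genWeightSpace ℂ L M χ, by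
      rw [codisjoint_iff, ← iSup_split_single, ← iSup_genWeightSpace_eq_top ℂ L M]⟩
  have hbot := (hM _ _ hcompl).resolve_left hχ
  rw [hbot] at hcompl
  exact ⟨χ, eq_top_of_isCompl_bot hcompl⟩

end Nilpotent

end LieModules

theorem IsCharModule.eq {L S : Type*} [LieRing L] [LieAlgebra ℂ L] [AddCommGroup S] [Module ℂ S]
    [LieRingModule L S] {χ χ' : LieAlgebra.LieCharacter ℂ L} (h : IsCharModule χ S)
    (h' : IsCharModule χ' S) : χ = χ' := by
  have := Module.nontrivial_of_finrank_eq_succ h.1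
  obtain ⟨s, hs⟩ := exists_ne (0 : S)
  exact DFunLike.ext _ _ fun x => smul_left_injective ℂ hs ((h.2 x s).symm.trans (h'.2 x s))

section Blocks

open LieModule

variable {𝔤 : Type u} [LieRing 𝔤] [LieAlgebra ℂ 𝔤] {𝔫 : LieSubalgebra ℂ 𝔤}
  [LieRing.IsNilpotent 𝔫] [LieModule.IsTrivial 𝔫 (𝔤 ⧸ 𝔫.toLieSubmodule)]

theorem Linked.exists_isCharModule {S T : IrrFD.{u, v} 𝔫} (h : Linked 𝔫 S T) :
    ∃ χ : LieAlgebra.LieCharacter ℂ 𝔫,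
      IsCharModule χ S.1.carrier ∧ IsCharModule χ T.1.carrier := by
  obtain ⟨χ, hχ⟩ := Whittaker.exists_isCharModule S.2
  refine ⟨χ, hχ, isCharModule_of_genWeightSpace_eq_top T.2 ?_⟩
  have hS := genWeightSpace_eq_top_of_forall_lie_eq_smul hχ.2
  cases h with
  | iso e => exact genWeightSpace_eq_top_of_surjective (f := e.toLieModuleHom) e.surjective hS
  | indec M hM hMS hMT =>
    have := S.2
    have := nontrivial_of_isIrreducible ℂ 𝔫 S.1.carrier
    obtain ⟨χ', hχ'⟩ := hM.exists_genWeightSpace_eq_top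
    rw [eq_of_genWeightSpace_eq_top hS (hMS.genWeightSpace_eq_top hχ')]
    exact hMT.genWeightSpace_eq_top hχ'
  | tensor h =>
    refine h.genWeightSpace_eq_top (genWeightSpace_eq_top_of_forall_lie_eq_smul fun x t => ?_)
    induction t with
    | zero => rw [lie_zero, smul_zero]
    | add s t hs ht => rw [lie_add, hs, ht, smul_add]
    | tmul g s =>
      rw [TensorProduct.LieModule.lie_tmul_right, trivial_lie_zero, TensorProduct.zero_tmul,
        zero_add, hχ.2, TensorProduct.tmul_smul]

theorem BlockRel.isCharModule_iff {S T : IrrFD.{u, v} 𝔫} (h : BlockRel 𝔫 S T)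
    {χ : LieAlgebra.LieCharacter ℂ 𝔫} :
    IsCharModule χ S.1.carrier ↔ IsCharModule χ T.1.carrier := by
  induction h with
  | rel S T h =>
    obtain ⟨χ', hS, hT⟩ := h.exists_isCharModule
    exact ⟨fun h => h.eq hS ▸ hT, fun h => h.eq hT ▸ hS⟩
  | refl _ => exact Iff.rfl
  | symm _ _ _ ih => exact ih.symm
  | trans _ _ _ _ _ ih₁ ih₂ => exact ih₁.trans ih₂

theorem inClass_iff_isCharModule {χ : LieAlgebra.LieCharacter ℂ 𝔫} {S : IrrFD.{u, v} 𝔫} :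
    InClass 𝔫 χ S ↔ IsCharModule χ S.1.carrier :=
  ⟨fun ⟨_, hT, hTS⟩ => hTS.isCharModule_iff.1 hT, fun h => ⟨S, h, Relation.EqvGen.refl S⟩⟩

theorem forall_hasFactor_inClass_iff {χ : LieAlgebra.LieCharacter ℂ 𝔫} {N : FDLieMod.{u, v} 𝔫} :
    (∀ S : IrrFD.{u, v} 𝔫, HasFactor (L := 𝔫) N.carrier S.1.carrier → InClass 𝔫 χ S) ↔
      genWeightSpace N.carrier χ = ⊤ := by
  simp only [inClass_iff_isCharModule]
  refine ⟨fun h => ?_, fun h S hS =>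
    isCharModule_of_genWeightSpace_eq_top S.2 (hS.genWeightSpace_eq_top h)⟩
  refine top_unique ((iSup_genWeightSpace_eq_top ℂ 𝔫 N.carrier).ge.trans (iSup_le fun χ' => ?_))
  obtain hbot | ⟨W, hW, hle⟩ := IsAtomic.eq_bot_or_exists_atom_le (genWeightSpace N.carrier χ')
  · exact hbot ▸ bot_le
  have hirr := isIrreducible_of_isAtom hW
  have := nontrivial_of_isIrreducible ℂ 𝔫 W
  have hfin : Module.Finite ℂ W := inferInstanceAs (Module.Finite ℂ W.toSubmodule)
  have hχ : IsCharModule χ W := h ⟨⟨W⟩, hirr⟩ (hasFactor_lieSubmodule W)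
  have hχ' : genWeightSpace W χ' = ⊤ := by
    rw [← comap_genWeightSpace_eq_of_injective W.injective_incl, eq_top_iff]
    exact fun w _ => hle w.2
  rw [eq_of_genWeightSpace_eq_top hχ' (genWeightSpace_eq_top_of_forall_lie_eq_smul hχ.2)]

end Blocks

/-! ### Modules over the enveloping algebra -/

theorem exists_isSimpleModule_quotient {A M : Type*} [Ring A] [AddCommGroup M] [Module A M] {v : M}
    (hv : v ≠ 0) : ∃ p q : Submodule A M, p ≤ q ∧ IsSimpleModule A (q ⧸ p.comap q.subtype) ∧
      v ∈ q ∧ v ∉ p := by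
  let q : Submodule A M := A ∙ v
  have hvq : v ∈ q := Submodule.mem_span_singleton_self v
  have : Nontrivial q := ⟨⟨v, hvq⟩, 0, fun h => hv (congrArg Subtype.val h)⟩
  obtain ⟨P, hP, -⟩ := (eq_top_or_exists_le_coatom (⊥ : Submodule A q)).resolve_left bot_ne_top
  have hcomap : (P.map q.subtype).comap q.subtype = P :=
    Submodule.comap_map_eq_of_injective q.injective_subtype P
  refine ⟨P.map q.subtype, q, Submodule.map_subtype_le q P, ?_, hvq, fun hvP => hP.1 ?_⟩
  · rw [hcomap]
    exact isSimpleModule_iff_isCoatom.2 hP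
  · rw [← hcomap, Submodule.comap_subtype_eq_top]
    exact (Submodule.span_singleton_le_iff_mem v _).2 hvP

section Adjoin

variable {K A : Type*} [CommRing K] [Ring A] [Algebra K A] {s : Set A}
  {M N : Type*} [AddCommGroup M] [Module K M] [Module A M] [IsScalarTower K A M]
  [AddCommGroup N] [Module K N] [Module A N] [IsScalarTower K A N]

theorem smul_mem_of_adjoin_eq_top (hs : Algebra.adjoin K s = ⊤) {W : Submodule K M}
    (hW : ∀ x ∈ s, ∀ m ∈ W, x • m ∈ W) (y : A) : ∀ m ∈ W, y • m ∈ W := by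
  induction (hs ▸ Algebra.mem_top : y ∈ Algebra.adjoin K s) using Algebra.adjoin_induction with
  | mem x hx => exact hW x hx
  | algebraMap r => exact fun m hm => by rw [algebraMap_smul]; exact W.smul_mem r hm
  | add y z _ _ hy hz => exact fun m hm => by rw [add_smul]; exact W.add_mem (hy m hm) (hz m hm)
  | mul y z _ _ hy hz => exact fun m hm => by rw [mul_smul]; exact hy _ (hz m hm)

theorem map_smul_of_adjoin_eq_top (hs : Algebra.adjoin K s = ⊤) {f : M →ₗ[K] N}
    (hf : ∀ x ∈ s, ∀ m, f (x • m) = x • f m) (y : A) : ∀ m, f (y • m) = y • f m := by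
  induction (hs ▸ Algebra.mem_top : y ∈ Algebra.adjoin K s) using Algebra.adjoin_induction with
  | mem x hx => exact hf x hx
  | algebraMap r => exact fun m => by rw [algebraMap_smul, algebraMap_smul, map_smul]
  | add y z _ _ hy hz => exact fun m => by rw [add_smul, map_add, hy, hz, add_smul]
  | mul y z _ _ hy hz => exact fun m => by rw [mul_smul, hy, hz, mul_smul]

end Adjoin

section Env

attribute [local instance] LieRing.ofAssociativeRing

theorem adjoin_range_ι_eq_top (R L : Type*) [CommRing R] [LieRing L] [LieAlgebra R L] :
    Algebra.adjoin R (Set.range (UniversalEnvelopingAlgebra.ι R : L → _)) = ⊤ := by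
  let S := Algebra.adjoin R (Set.range (UniversalEnvelopingAlgebra.ι R : L → _))
  let f : L →ₗ⁅R⁆ S :=
    { toFun := fun x => ⟨UniversalEnvelopingAlgebra.ι R x, Algebra.subset_adjoin ⟨x, rfl⟩⟩
      map_add' := fun x y => Subtype.ext (map_add _ x y)
      map_smul' := fun c x => Subtype.ext (map_smul _ c x)
      map_lie' := fun {x y} => Subtype.ext (LieHom.map_lie _ x y) }
  have hf : S.val.comp (UniversalEnvelopingAlgebra.lift R f) = AlgHom.id R _ := by
    ext x
    simp [f]
  refine eq_top_iff.2 fun u _ => ?_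
  rw [← AlgHom.id_apply (R := R) u, ← hf]
  exact (UniversalEnvelopingAlgebra.lift R f u).2

theorem adjoin_range_ι_basis_eq_top {ι R L : Type*} [CommRing R] [LieRing L] [LieAlgebra R L]
    (B : Module.Basis ι R L) :
    Algebra.adjoin R (Set.range fun i => UniversalEnvelopingAlgebra.ι R (B i)) = ⊤ := by
  refine top_unique ((adjoin_range_ι_eq_top R L).ge.trans (Algebra.adjoin_le ?_))
  rintro _ ⟨x, rfl⟩
  have hx := Submodule.mem_map_of_mem
    (f := (UniversalEnvelopingAlgebra.ι R : L →ₗ⁅R⁆ UniversalEnvelopingAlgebra R L).toLinearMap)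
    (B.mem_span x)
  rw [Submodule.map_span, ← Set.range_comp] at hx
  exact Algebra.span_le_adjoin _ _ hx

variable {𝔤 : Type u} [LieRing 𝔤] [LieAlgebra ℂ 𝔤]
  {M : Type v} [AddCommGroup M] [Module ℂ M] [Module (UniversalEnvelopingAlgebra ℂ 𝔤) M]
  [IsScalarTower ℂ (UniversalEnvelopingAlgebra ℂ 𝔤) M]
  {N : Type w} [AddCommGroup N] [Module ℂ N] [Module (UniversalEnvelopingAlgebra ℂ 𝔤) N]
  [IsScalarTower ℂ (UniversalEnvelopingAlgebra ℂ 𝔤) N]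

variable (M) in
/-- The action of an element of the Lie algebra on a module over the enveloping algebra. -/
noncomputable def act (x : 𝔤) : Module.End ℂ M :=
  Algebra.lsmul ℂ ℂ M (UniversalEnvelopingAlgebra.ι ℂ x)

theorem act_apply (x : 𝔤) (m : M) : act M x m = UniversalEnvelopingAlgebra.ι ℂ x • m := rfl

theorem map_act (f : M →ₗ[UniversalEnvelopingAlgebra ℂ 𝔤] N) (x : 𝔤) (m : M) :
    f (act M x m) = act N x (f m) :=
  f.map_smul _ m

theorem act_lie (x y : 𝔤) : act M ⁅x, y⁆ = act M x * act M y - act M y * act M x := by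
  rw [act, LieHom.map_lie, LieRing.of_associative_ring_bracket, map_sub, map_mul, map_mul]
  rfl

/-- A subspace stable under a basis of the Lie algebra, as a submodule. -/
def submoduleOfStable {ι : Type*} (B : Module.Basis ι ℂ 𝔤) (W : Submodule ℂ M)
    (hW : ∀ i, ∀ m ∈ W, act M (B i) m ∈ W) : Submodule (UniversalEnvelopingAlgebra ℂ 𝔤) M :=
  { W with
    smul_mem' := fun y => smul_mem_of_adjoin_eq_top (adjoin_range_ι_basis_eq_top B)
      (by rintro _ ⟨i, rfl⟩; exact hW i) y _ }

/-- A linear map that commutes with a basis of the Lie algebra, as a homomorphism of modules. -/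
def linearMapOfCommute {ι : Type*} (B : Module.Basis ι ℂ 𝔤) (f : M →ₗ[ℂ] N)
    (hf : ∀ i m, f (act M (B i) m) = act N (B i) (f m)) :
    M →ₗ[UniversalEnvelopingAlgebra ℂ 𝔤] N :=
  { f with
    map_smul' := map_smul_of_adjoin_eq_top (adjoin_range_ι_basis_eq_top B)
      (by rintro _ ⟨i, rfl⟩; exact hf i) }

theorem isFiniteLength_of_finite [Module.Finite ℂ M] :
    IsFiniteLength (UniversalEnvelopingAlgebra ℂ 𝔤) M :=
  isFiniteLength_iff_isNoetherian_isArtinian.2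
    ⟨isNoetherian_of_tower ℂ inferInstance, isArtinian_of_tower ℂ inferInstance⟩

section Relation

variable {a b : 𝔤} (hab : ⁅a, b⁆ = b)

include hab

theorem act_mul_sub_mul_act : act M a * act M b - act M b * act M a = act M b := by
  rw [← act_lie, hab]

theorem act_act (m : M) : act M a (act M b m) = act M b (act M a m) + act M b m :=
  sub_eq_iff_eq_add'.1 (LinearMap.congr_fun (act_mul_sub_mul_act hab) m)

theorem isNilpotent_act [Module.Finite ℂ M] : IsNilpotent (act M b) :=
  isNilpotent_of_mul_sub_mul_eq ℂ (act_mul_sub_mul_act hab)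

theorem act_mem_maxGenEigenspace_zero {m : M} (hm : m ∈ (act M b).maxGenEigenspace 0) :
    act M a m ∈ (act M b).maxGenEigenspace 0 := by
  rw [mem_maxGenEigenspace_zero] at *
  obtain ⟨k, hk⟩ := hm
  have hpow := LinearMap.congr_fun
    (mul_pow_sub_pow_mul_of_mul_sub_mul_eq (act_mul_sub_mul_act (M := M) hab) k) m
  refine ⟨k, ?_⟩
  simpa only [LinearMap.sub_apply, Module.End.mul_apply, hk, map_zero, zero_sub, neg_eq_zero]
    using hpow

theorem act_mem_maxGenEigenspace_add_one {μ : ℂ} {m : M}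
    (hm : m ∈ (act M a).maxGenEigenspace μ) : act M b m ∈ (act M a).maxGenEigenspace (μ + 1) :=
  map_mem_maxGenEigenspace_of_shift (fun m => by rw [act_act hab, add_sub_cancel_left, one_smul]) hm

end Relation

variable (B : Module.Basis (Fin 2) ℂ 𝔤) (hB : ⁅B 0, B 1⁆ = B 1)

/-- The submodule of vectors killed by a power of `b = B 1`. -/
noncomputable def nilSubmodule (M : Type v) [AddCommGroup M] [Module ℂ M]
    [Module (UniversalEnvelopingAlgebra ℂ 𝔤) M]
    [IsScalarTower ℂ (UniversalEnvelopingAlgebra ℂ 𝔤) M] :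
    Submodule (UniversalEnvelopingAlgebra ℂ 𝔤) M :=
  submoduleOfStable B ((act M (B 1)).maxGenEigenspace 0) <| Fin.forall_fin_two.2
    ⟨fun _ => act_mem_maxGenEigenspace_zero hB, fun _ => map_mem_maxGenEigenspace fun _ => rfl⟩

include hB

-- The kernel of `b` is a nonzero submodule, so `b = 0` and `a`-stable subspaces are submodules.
theorem exists_isL_of_isSimpleModule [IsSimpleModule (UniversalEnvelopingAlgebra ℂ 𝔤) M]
    (hnil : (act M (B 1)).maxGenEigenspace 0 = ⊤) : ∃ μ : ℂ, IsL (B 0) (B 1) μ M := by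
  have := IsSimpleModule.nontrivial (UniversalEnvelopingAlgebra ℂ 𝔤) M
  have stable (W : Submodule ℂ M) (hW : ∀ i, ∀ m ∈ W, act M (B i) m ∈ W) : W = ⊥ ∨ W = ⊤ :=
    (eq_bot_or_eq_top (submoduleOfStable B W hW)).imp
      (congrArg (Submodule.restrictScalars ℂ)) (congrArg (Submodule.restrictScalars ℂ))
  have hker : LinearMap.ker (act M (B 1)) = ⊤ := by
    refine (stable _ (Fin.forall_fin_two.2 ⟨fun m hm => ?_, fun m hm => ?_⟩)).resolve_left fun h =>
      bot_ne_top ((maxGenEigenspace_eq_bot fun h0 => h0 ?_).symm.trans hnil)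
    · have hcomm := act_act hB m
      rw [LinearMap.mem_ker] at *
      rwa [hm, map_zero, add_zero, eq_comm] at hcomm
    · rw [LinearMap.mem_ker] at *
      rw [hm, map_zero]
    · exact (Module.End.eigenspace_zero _).trans h
  have hb (m : M) : act M (B 1) m = 0 := LinearMap.congr_fun (LinearMap.ker_eq_top.1 hker) m
  have hrank : Module.finrank ℂ M = 1 :=
    finrank_eq_one_of_forall_invtSubmodule (act M (B 0)) fun W hW => stable W <|
      Fin.forall_fin_two.2 ⟨hW, fun m _ => by rw [hb]; exact W.zero_mem⟩
  obtain ⟨μ, hμ, -⟩ := LinearMap.existsUnique_eq_smul_id_of_finrank_eq_one hrank (act M (B 0))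
  exact ⟨μ, hrank, fun m => ⟨hb m, LinearMap.congr_fun hμ m⟩⟩

theorem finite_of_isFiniteLength (M : Type v) [AddCommGroup M]
    [Module (UniversalEnvelopingAlgebra ℂ 𝔤) M]
    (h : IsFiniteLength (UniversalEnvelopingAlgebra ℂ 𝔤) M) :
    ∀ [Module ℂ M] [IsScalarTower ℂ (UniversalEnvelopingAlgebra ℂ 𝔤) M],
      (act M (B 1)).maxGenEigenspace 0 = ⊤ → Module.Finite ℂ M := by
  induction h with
  | of_subsingleton => intros; infer_instance
  | @of_simple_quotient M _ _ N _ _ ih =>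
    intro _ _ hnil
    have hN : Module.Finite ℂ (N.restrictScalars ℂ) := ih <|
      maxGenEigenspace_eq_top_of_injective (f := N.subtype.restrictScalars ℂ) N.injective_subtype
        (fun _ => rfl) hnil
    obtain ⟨μ, hμ⟩ := exists_isL_of_isSimpleModule (M := M ⧸ N) B hB <|
      maxGenEigenspace_eq_top_of_surjective (f := N.mkQ.restrictScalars ℂ) N.mkQ_surjective
        (fun _ => rfl) hnil
    have : Module.Finite ℂ (M ⧸ N.restrictScalars ℂ) := Module.finite_of_finrank_eq_succ hμ.1
    exact Module.Finite.of_submodule_quotient (N.restrictScalars ℂ)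

end Env

/-! ### The finite-length block of zero -/

section Induced

variable {𝔤 : Type u} [LieRing 𝔤] [LieAlgebra ℂ 𝔤] {𝔫 : LieSubalgebra ℂ 𝔤}
  {χ : LieAlgebra.LieCharacter ℂ 𝔫} {M : GMod.{u, v} 𝔤}

-- Frobenius reciprocity: homomorphisms `Ind N → M` are the `𝔫`-equivariant maps `N → M`.
theorem apply_mem_blockTrace {N : FDLieMod.{u, v} 𝔫}
    (hN : ∀ S : IrrFD.{u, v} 𝔫, HasFactor (L := 𝔫) N.carrier S.1.carrier → InClass 𝔫 χ S)
    {g : N.carrier →ₗ[ℂ] M} (hg : ∀ (x : 𝔫) n, g ⁅x, n⁆ = act M (x : 𝔤) (g n)) (n : N.carrier) :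
    g n ∈ blockTrace 𝔫 χ M := by
  let f : UniversalEnvelopingAlgebra ℂ 𝔤 ⊗[ℂ] N.carrier →ₗ[UniversalEnvelopingAlgebra ℂ 𝔤] M :=
    TensorProduct.AlgebraTensorModule.lift
      (LinearMap.toSpanSingleton (UniversalEnvelopingAlgebra ℂ 𝔤) (N.carrier →ₗ[ℂ] M) g)
  have hf (y) (n : N.carrier) : f (y ⊗ₜ[ℂ] n) = y • g n := rfl
  have hker : indRel 𝔫 N.carrier ≤ LinearMap.ker f := by
    refine Submodule.span_le.2 ?_
    rintro _ ⟨y, x, n, rfl⟩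
    rw [SetLike.mem_coe, LinearMap.mem_ker, map_sub, hf, hf, hg, act_apply, mul_smul, sub_self]
  have hle : LinearMap.range ((indRel 𝔫 N.carrier).liftQ f hker) ≤ blockTrace 𝔫 χ M :=
    le_iSup_of_le N (le_iSup_of_le hN (le_iSup_of_le _ le_rfl))
  exact hle ⟨Submodule.Quotient.mk (1 ⊗ₜ n), one_smul _ (g n)⟩

theorem blockTrace_le {P : Submodule (UniversalEnvelopingAlgebra ℂ 𝔤) M}
    (hP : ∀ N : FDLieMod.{u, v} 𝔫,
      (∀ S : IrrFD.{u, v} 𝔫, HasFactor (L := 𝔫) N.carrier S.1.carrier → InClass 𝔫 χ S) →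
      ∀ g : N.carrier →ₗ[ℂ] M, (∀ (x : 𝔫) n, g ⁅x, n⁆ = act M (x : 𝔤) (g n)) → ∀ n, g n ∈ P) :
    blockTrace 𝔫 χ M ≤ P := by
  refine iSup_le fun N => iSup_le fun hN => iSup_le fun f => ?_
  let g : N.carrier →ₗ[ℂ] M := f.restrictScalars ℂ ∘ₗ
    (indRel 𝔫 N.carrier).mkQ.restrictScalars ℂ ∘ₗ TensorProduct.mk ℂ _ N.carrier 1
  have hgen (y) (n : N.carrier) : f ((indRel 𝔫 N.carrier).mkQ (y ⊗ₜ[ℂ] n)) = y • g n := by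
    rw [← mul_one y, ← smul_eq_mul, ← TensorProduct.smul_tmul', map_smul, map_smul]
    simp only [smul_eq_mul, mul_one]
    rfl
  have hg (x : 𝔫) (n : N.carrier) : g ⁅x, n⁆ = act M (x : 𝔤) (g n) := by
    rw [act_apply, ← hgen]
    refine congrArg f (Eq.symm ((Submodule.Quotient.eq _).2 (Submodule.subset_span ⟨1, x, n, ?_⟩)))
    rw [one_mul]
    rfl
  rintro _ ⟨t, rfl⟩
  obtain ⟨t, rfl⟩ := (indRel 𝔫 N.carrier).mkQ_surjective t
  induction t with
  | zero => rw [map_zero, map_zero]; exact P.zero_mem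
  | add s t hs ht => rw [map_add, map_add]; exact P.add_mem hs ht
  | tmul y n => rw [hgen]; exact P.smul_mem y (hP N hN g hg n)

variable (𝔫) in
/-- The restriction of a finite-dimensional `𝔤`-module to `𝔫`. -/
noncomputable def restrictFD (M : GMod.{u, v} 𝔤) [Module.Finite ℂ M] : FDLieMod.{u, v} 𝔫 :=
  let : LieRingModule 𝔫 M :=
    { bracket := fun x m => act M (x : 𝔤) m
      add_lie := fun x y m => by
        change act M ((x : 𝔤) + (y : 𝔤)) m = act M (x : 𝔤) m + act M (y : 𝔤) m
        simp only [act_apply, map_add, add_smul]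
      lie_add := fun x => map_add (act M (x : 𝔤))
      leibniz_lie := fun x y m => by
        change act M (x : 𝔤) (act M (y : 𝔤) m) =
          act M ⁅(x : 𝔤), (y : 𝔤)⁆ m + act M (y : 𝔤) (act M (x : 𝔤) m)
        rw [act_lie, LinearMap.sub_apply, Module.End.mul_apply, Module.End.mul_apply,
          sub_add_cancel] }
  have : LieModule ℂ 𝔫 M :=
    { smul_lie := fun c x m => by
        change act M (c • (x : 𝔤)) m = c • act M (x : 𝔤) m
        simp only [act_apply, map_smul, smul_assoc]
      lie_smul := fun c x => map_smul (act M (x : 𝔤)) c }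
  ⟨M⟩

theorem isTrivial_quotient_toLieSubmodule (h𝔫 : ∀ (x : 𝔫) (y : 𝔤), ⁅(x : 𝔤), y⁆ ∈ 𝔫) :
    LieModule.IsTrivial 𝔫 (𝔤 ⧸ 𝔫.toLieSubmodule) where
  trivial x y := by
    obtain ⟨y, rfl⟩ := LieSubmodule.Quotient.surjective_mk' _ y
    exact (LieSubmodule.Quotient.mk_eq_zero (N := 𝔫.toLieSubmodule)).2 (h𝔫 x y)

variable [LieRing.IsNilpotent 𝔫] [LieModule.IsTrivial 𝔫 (𝔤 ⧸ 𝔫.toLieSubmodule)]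

theorem blockTrace_zero_eq_top [Module.Finite ℂ M]
    (hM : ∀ x : 𝔫, IsNilpotent (act M (x : 𝔤))) : blockTrace 𝔫 0 M = ⊤ := by
  refine eq_top_iff.2 fun m _ => apply_mem_blockTrace (N := restrictFD 𝔫 M) (g := LinearMap.id)
    (forall_hasFactor_inClass_iff.2 (eq_top_iff.2 fun n _ => ?_)) (fun _ _ => rfl) m
  refine (LieModule.mem_genWeightSpace _ _ _).2 fun x => ?_
  obtain ⟨k, hk⟩ := hM x
  exact (Module.End.mem_maxGenEigenspace (act M (x : 𝔤)) 0 n).1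
    (mem_maxGenEigenspace_zero.2 ⟨k, LinearMap.congr_fun hk n⟩)

theorem blockTrace_zero_le {x : 𝔫} {P : Submodule (UniversalEnvelopingAlgebra ℂ 𝔤) M}
    (hP : ∀ m ∈ (act M (x : 𝔤)).maxGenEigenspace 0, m ∈ P) : blockTrace 𝔫 0 M ≤ P := by
  refine blockTrace_le fun N hN g hg n => hP _ ?_
  refine map_mem_maxGenEigenspace (A := LieModule.toEnd ℂ 𝔫 N.carrier x) (fun n => (hg x n).symm) ?_
  rw [forall_hasFactor_inClass_iff] at hN
  have hn : n ∈ LieModule.genWeightSpace N.carrier (0 : 𝔫 → ℂ) := hN ▸ LieSubmodule.mem_top n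
  exact Module.End.mem_maxGenEigenspace _ _ _ |>.2 (LieModule.mem_genWeightSpace _ _ _ |>.1 hn x)

end Induced

section FinBlock

variable {𝔤 : Type u} [LieRing 𝔤] [LieAlgebra ℂ 𝔤] (B : Module.Basis (Fin 2) ℂ 𝔤)
  (hB : ⁅B 0, B 1⁆ = B 1) (𝔫 : LieSubalgebra ℂ 𝔤)
  (h𝔫 : 𝔫.toSubmodule = Submodule.span ℂ {B 1}) (M : GMod.{u, v} 𝔤)

include hB h𝔫

theorem finBlock_iff_finite : finBlock.{u, v} 𝔫 0 M ↔ Module.Finite ℂ M := by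
  have hmem (y : 𝔤) : y ∈ 𝔫 ↔ ∃ c : ℂ, c • B 1 = y := by
    rw [← LieSubalgebra.mem_toSubmodule, h𝔫, Submodule.mem_span_singleton]
  have : IsLieAbelian 𝔫 := ⟨by
    rintro ⟨x, hx⟩ ⟨y, hy⟩
    obtain ⟨c, rfl⟩ := (hmem x).1 hx
    obtain ⟨d, rfl⟩ := (hmem y).1 hy
    exact Subtype.ext (by simp)⟩
  have : LieModule.IsTrivial 𝔫 (𝔤 ⧸ 𝔫.toLieSubmodule) := isTrivial_quotient_toLieSubmodule <| by
    rintro ⟨x, hx⟩ y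
    obtain ⟨c, rfl⟩ := (hmem x).1 hx
    refine (hmem _).2 ⟨-(c * B.repr y 0), ?_⟩
    nth_rewrite 2 [← B.sum_repr y]
    rw [Fin.sum_univ_two, lie_add, lie_smul, lie_smul, smul_lie, smul_lie, lie_self, ← lie_skew, hB]
    module
  constructor
  · rintro ⟨⟨-, htr⟩, hlen⟩
    refine finite_of_isFiniteLength B hB M hlen (eq_top_iff.2 fun m _ => ?_)
    have hle : blockTrace 𝔫 0 M ≤ nilSubmodule B hB M :=
      blockTrace_zero_le (x := ⟨B 1, (hmem _).2 ⟨1, one_smul _ _⟩⟩) fun _ hm => hm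
    exact hle (htr ▸ Submodule.mem_top)
  · intro hM
    refine ⟨⟨fun m => inferInstance, blockTrace_zero_eq_top fun x => ?_⟩, isFiniteLength_of_finite⟩
    obtain ⟨c, hc⟩ := (hmem x).1 x.2
    exact isNilpotent_act (a := B 0) (by rw [← hc, lie_smul, hB])

theorem finBlockAt_iff (ξ : CModZ) :
    finBlockAt.{u, v} 𝔫 0 (B 0) (B 1) ξ M ↔
      Module.Finite ℂ M ∧ ∀ μ : ℂ, (act M (B 0)).HasEigenvalue μ → (μ : CModZ) = ξ := by
  rw [finBlockAt, finBlock_iff_finite B hB 𝔫 h𝔫]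
  refine and_congr_right fun hfin => ⟨fun h μ hμ => ?_, fun h p q _ hsimple => ?_⟩
  · obtain ⟨v, hv⟩ := hμ.exists_hasEigenvector
    obtain ⟨p, q, hpq, hsimple, hvq, hvp⟩ :=
      exists_isSimpleModule_quotient (A := UniversalEnvelopingAlgebra ℂ 𝔤) hv.2
    obtain ⟨ν, hν, hL⟩ := h p q hpq hsimple
    let v' : q ⧸ p.comap q.subtype := (p.comap q.subtype).mkQ ⟨v, hvq⟩
    have hv' : v' ≠ 0 := fun h0 => hvp ((Submodule.Quotient.mk_eq_zero (p.comap q.subtype)).1 h0)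
    have hμ' : UniversalEnvelopingAlgebra.ι ℂ (B 0) • v' = μ • v' :=
      congrArg (p.comap q.subtype).mkQ (Subtype.ext hv.apply_eq_smul)
    rwa [smul_left_injective ℂ hv' (hμ'.symm.trans (hL.2 v').2)]
  · have : Module.Finite ℂ q := inferInstanceAs (Module.Finite ℂ (q.restrictScalars ℂ))
    have hnil : (act (q ⧸ p.comap q.subtype) (B 1)).maxGenEigenspace 0 = ⊤ := by
      obtain ⟨k, hk⟩ := isNilpotent_act (M := q ⧸ p.comap q.subtype) hB
      exact eq_top_iff.2 fun m _ => mem_maxGenEigenspace_zero.2 ⟨k, LinearMap.congr_fun hk m⟩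
    obtain ⟨μ, hL⟩ := exists_isL_of_isSimpleModule B hB hnil
    refine ⟨μ, h μ ?_, hL⟩
    have hμ : (act (q ⧸ p.comap q.subtype) (B 0)).HasEigenvalue μ := by
      have := Module.nontrivial_of_finrank_eq_succ hL.1
      obtain ⟨y, hy⟩ := exists_ne (0 : q ⧸ p.comap q.subtype)
      exact Module.End.hasEigenvalue_of_hasEigenvector
        ⟨Module.End.mem_eigenspace_iff.2 (hL.2 y).2, hy⟩
    have hμq : (act q (B 0)).HasEigenvalue μ :=
      hasEigenvalue_of_surjective (p := (p.comap q.subtype).mkQ.restrictScalars ℂ)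
        (p.comap q.subtype).mkQ_surjective (fun _ => rfl) hμ
    exact hasEigenvalue_of_injective (f := q.subtype.restrictScalars ℂ) q.injective_subtype
      (fun _ => rfl) hμq

end FinBlock

/-! ### Direct sums of categories of modules -/

open DirectSum

theorem directSum_eq_lof {ι R : Type*} [DecidableEq ι] [Ring R] {V : ι → Type*}
    [∀ i, AddCommGroup (V i)] [∀ i, Module R (V i)] {i : ι} {y : ⨁ i, V i}
    (h : ∀ j, j ≠ i → y j = 0) : y = lof R ι V i (y i) := by
  refine DFinsupp.ext fun j => ?_
  obtain rfl | hj := eq_or_ne j i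
  · exact (lof_apply R j (y j)).symm
  · rw [h j hj]
    exact (of_eq_of_ne i j (y i) hj).symm

theorem finite_directSum {ι R : Type*} [Ring R] {V : ι → Type*} [∀ i, AddCommGroup (V i)]
    [∀ i, Module R (V i)] [∀ i, Module.Finite R (V i)] (h : {i | Nontrivial (V i)}.Finite) :
    Module.Finite R (⨁ i, V i) := by
  classical
  have := h.to_subtype
  have htop : ⨆ i : {i | Nontrivial (V i)}, LinearMap.range (lof R ι V i) = ⊤ := by
    refine eq_top_iff.2 fun y _ => ?_
    induction y using DirectSum.induction_on with
    | zero => exact zero_mem _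
    | of i x =>
      obtain hi | hi := subsingleton_or_nontrivial (V i)
      · rw [Subsingleton.elim x 0, map_zero]
        exact zero_mem _
      · exact Submodule.mem_iSup_of_mem (⟨i, hi⟩ : {i | Nontrivial (V i)}) ⟨x, rfl⟩
    | add x y hx hy => exact add_mem (hx trivial) (hy trivial)
  exact ⟨htop ▸ Submodule.fg_iSup _ fun i => Module.Finite.iff_fg.1 inferInstance⟩

theorem isZero_fullSubcategory_iff {C : Type*} [Category* C] [HasZeroMorphisms C]
    {P : ObjectProperty C} (X : P.FullSubcategory) : IsZero X ↔ IsZero X.obj := by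
  rw [IsZero.iff_id_eq_zero, IsZero.iff_id_eq_zero]
  exact ⟨congrArg InducedCategory.Hom.hom, ObjectProperty.hom_ext P⟩

section SumFunctor

variable {R : Type u} [Ring R] {ι : Type w} {P : ObjectProperty (ModuleCat.{max w v} R)}
  {Q : ι → ObjectProperty (ModuleCat.{max w v} R)}
  (hsum : ∀ X : DirectSumCat fun i => (Q i).FullSubcategory,
    P (ModuleCat.of R (⨁ i, (X.obj i).obj)))

/-- The functor `(M i) ↦ ⨁ i, M i` on families of modules in `Q i`, with values in `P`. -/
noncomputable def sumFunctor :
    (DirectSumCat fun i => (Q i).FullSubcategory) ⥤ P.FullSubcategory where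
  obj X := ⟨ModuleCat.of R (⨁ i, (X.obj i).obj), hsum X⟩
  map f := ObjectProperty.homMk (ModuleCat.ofHom (lmap fun i => (f.hom i).hom.hom))
  map_id _ := ObjectProperty.hom_ext _ (ModuleCat.hom_ext lmap_id)
  map_comp _ _ := ObjectProperty.hom_ext _ (ModuleCat.hom_ext (lmap_comp _ _))

theorem sumFunctor_faithful : (sumFunctor hsum).Faithful where
  map_injective {X Y} f g h := by
    classical
    refine ObjectProperty.hom_ext _ (funext fun i => ObjectProperty.hom_ext _
      (ModuleCat.hom_ext (LinearMap.ext fun x => of_injective (β := fun i => (Y.obj i).obj) i ?_)))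
    exact (lmap_lof (fun i => (f.hom i).hom.hom) i x).symm.trans <|
      (congrArg (fun g => g.hom.hom (lof R ι (fun i => (X.obj i).obj) i x)) h).trans <|
        lmap_lof (fun i => (g.hom i).hom.hom) i x

theorem sumFunctor_full
    (horth : ∀ ⦃i j⦄, i ≠ j → ∀ ⦃M N⦄, Q i M → Q j N → ∀ (f : M →ₗ[R] N) m, f m = 0) :
    (sumFunctor hsum).Full where
  map_surjective {X Y} g := by
    classical
    let f (i j) : (X.obj i).obj →ₗ[R] (Y.obj j).obj :=
      component R ι (fun j => (Y.obj j).obj) j ∘ₗ g.hom.hom ∘ₗ lof R ι (fun i => (X.obj i).obj) i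
    have hf (i j) (hji : j ≠ i) (x) : f i j x = 0 :=
      horth hji.symm (X.obj i).property (Y.obj j).property (f i j) x
    refine ⟨ObjectProperty.homMk fun i => ObjectProperty.homMk (ModuleCat.ofHom (f i i)), ?_⟩
    exact ObjectProperty.hom_ext _ (ModuleCat.hom_ext (linearMap_ext _ fun i =>
      LinearMap.ext fun x => (lmap_lof (fun i => f i i) i x).trans
        (directSum_eq_lof (R := R) fun j hj => hf i j hj x).symm))

variable [DecidableEq ι]

/-- The inclusions `M i ⟶ ⨁ i, M i`, as a natural transformation. -/
noncomputable def sumInclusion (hQ : ∀ i, Q i ≤ P) (i : ι) :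
    DirectSumCat.proj (fun i => (Q i).FullSubcategory) i ⋙ ObjectProperty.ιOfLE (hQ i) ⟶
      sumFunctor hsum where
  app X := ObjectProperty.homMk (ModuleCat.ofHom (lof R ι (fun i => (X.obj i).obj) i))
  naturality _ _ f := ObjectProperty.hom_ext _ (ModuleCat.hom_ext (LinearMap.ext fun x =>
    (lmap_lof (fun i => (f.hom i).hom.hom) i x).symm))

/-- The inclusions `M i ⟶ ⨁ i, M i` form a coproduct cofan. -/
noncomputable def isColimitSum (hQ : ∀ i, Q i ≤ P)
    (X : DirectSumCat fun i => (Q i).FullSubcategory) :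
    IsColimit (Cofan.mk ((sumFunctor hsum).obj X) fun i => (sumInclusion hsum hQ i).app X) :=
  Cofan.IsColimit.mk _
    (fun t => ObjectProperty.homMk (ModuleCat.ofHom (toModule R ι _ fun i => (t.inj i).hom.hom)))
    (fun t i => ObjectProperty.hom_ext _ (ModuleCat.hom_ext (LinearMap.ext fun x =>
      toModule_lof R (φ := fun i => (t.inj i).hom.hom) i x)))
    fun t _ hm => ObjectProperty.hom_ext _ (ModuleCat.hom_ext (linearMap_ext _ fun i =>
      LinearMap.ext fun x => (congrArg (fun g => g.hom.hom x) (hm i)).trans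
        (toModule_lof R (φ := fun i => (t.inj i).hom.hom) i x).symm))

theorem sumFunctor_essSurj
    (hdec : ∀ M, P M → IsNoetherian R M ∧ ∃ S : ι → Submodule R M,
      DirectSum.IsInternal S ∧ ∀ i, Q i (ModuleCat.of R (S i))) :
    (sumFunctor hsum).EssSurj where
  mem_essImage M := by
    obtain ⟨_, S, hint, hS⟩ := hdec M.obj M.property
    have hfin : {i | ¬ IsZero (⟨ModuleCat.of R (S i), hS i⟩ : (Q i).FullSubcategory)}.Finite := by
      refine (WellFoundedGT.finite_ne_bot_of_iSupIndep
        hint.submodule_iSupIndep).subset fun i hi hbot => hi ?_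
      rw [isZero_fullSubcategory_iff, ModuleCat.isZero_iff_subsingleton]
      exact Submodule.subsingleton_iff_eq_bot.2 hbot
    exact ⟨⟨_, hfin⟩, ⟨ObjectProperty.isoMk _
      (LinearEquiv.ofBijective (coeLinearMap S) hint).toModuleIso⟩⟩

end SumFunctor

/-! ### The decomposition over `ℂ / ℤ` -/

section Component

variable {𝔤 : Type u} [LieRing 𝔤] [LieAlgebra ℂ 𝔤] (B : Module.Basis (Fin 2) ℂ 𝔤)
  (hB : ⁅B 0, B 1⁆ = B 1)
variable {M : Type v} [AddCommGroup M] [Module ℂ M] [Module (UniversalEnvelopingAlgebra ℂ 𝔤) M]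
  [IsScalarTower ℂ (UniversalEnvelopingAlgebra ℂ 𝔤) M]

/-- The sum of the generalized eigenspaces of an operator for the eigenvalues in `ξ`. -/
def eigenFiber (f : Module.End ℂ M) (ξ : CModZ) : Submodule ℂ M :=
  ⨆ μ ∈ {μ : ℂ | (μ : CModZ) = ξ}, f.maxGenEigenspace μ

theorem map_mem_eigenFiber {f g : Module.End ℂ M} {c : ℂ} (hc : (c : CModZ) = 0)
    (hg : ∀ μ, ∀ m ∈ f.maxGenEigenspace μ, g m ∈ f.maxGenEigenspace (μ + c)) {ξ : CModZ} {m : M}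
    (hm : m ∈ eigenFiber f ξ) : g m ∈ eigenFiber f ξ := by
  have hle : eigenFiber f ξ ≤ (eigenFiber f ξ).comap g := iSup₂_le fun μ hμ m hm =>
    Submodule.mem_iSup_of_mem (μ + c) <| Submodule.mem_iSup_of_mem
      (by rw [Set.mem_ofPred_eq, QuotientAddGroup.mk_add, hc, add_zero]; exact hμ) (hg μ m hm)
  exact hle hm

theorem isInternal_eigenFiber [DecidableEq CModZ] [Module.Finite ℂ M] (f : Module.End ℂ M) :
    DirectSum.IsInternal (eigenFiber f) := by
  rw [isInternal_submodule_iff_iSupIndep_and_iSup_eq_top]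
  refine ⟨fun ξ => ?_, eq_top_iff.2 (f.iSup_maxGenEigenspace_eq_top.ge.trans (iSup_le fun μ =>
    le_iSup_of_le (μ : CModZ) (le_biSup f.maxGenEigenspace (rfl : (μ : CModZ) = μ))))⟩
  have hdisj : Disjoint {μ : ℂ | (μ : CModZ) = ξ} {μ : ℂ | (μ : CModZ) ≠ ξ} :=
    Set.disjoint_left.2 fun _ h1 h2 => h2 h1
  refine (f.independent_maxGenEigenspace.disjoint_biSup_biSup hdisj).mono_right ?_
  exact iSup₂_le fun η hη => biSup_mono fun μ hμ => ne_of_eq_of_ne hμ hη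

variable (M) in
/-- The sum of the generalized eigenspaces of `a = B 0` for the eigenvalues in `ξ`, which is a
submodule since `b = B 1` shifts eigenvalues by one. -/
noncomputable def eigenComponent (ξ : CModZ) : Submodule (UniversalEnvelopingAlgebra ℂ 𝔤) M :=
  submoduleOfStable B (eigenFiber (act M (B 0)) ξ) <| Fin.forall_fin_two.2
    ⟨fun _ => map_mem_eigenFiber (c := 0) rfl fun μ _ hm => by
        rw [add_zero]
        exact map_mem_maxGenEigenspace (fun _ => rfl) hm,
      fun _ => map_mem_eigenFiber (c := 1) (by simp) fun _ _ =>
        act_mem_maxGenEigenspace_add_one hB⟩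

theorem isInternal_eigenComponent [DecidableEq CModZ] [Module.Finite ℂ M] :
    DirectSum.IsInternal (eigenComponent B hB M) :=
  isInternal_eigenFiber (act M (B 0))

theorem coe_eq_of_hasEigenvalue_eigenComponent {ξ : CModZ} {μ : ℂ}
    (h : (act (eigenComponent B hB M ξ) (B 0)).HasEigenvalue μ) : (μ : CModZ) = ξ := by
  by_contra hμ
  obtain ⟨v, hv⟩ := h.exists_hasEigenvector
  have hdisj := (act M (B 0)).independent_maxGenEigenspace.disjoint_biSup
    (y := {μ : ℂ | (μ : CModZ) = ξ}) hμ
  refine hv.2 (Subtype.ext (Submodule.disjoint_def.1 hdisj v ?_ v.2))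
  exact Module.End.eigenspace_le_maxGenEigenspace
    (Module.End.mem_eigenspace_iff.2 (congrArg Subtype.val hv.apply_eq_smul))

theorem linearMap_eq_zero_of_disjoint_hasEigenvalue [Module.Finite ℂ M] {N : Type w}
    [AddCommGroup N] [Module ℂ N] [Module (UniversalEnvelopingAlgebra ℂ 𝔤) N]
    [IsScalarTower ℂ (UniversalEnvelopingAlgebra ℂ 𝔤) N] {x : 𝔤}
    (h : ∀ μ, (act M x).HasEigenvalue μ → ¬ (act N x).HasEigenvalue μ)
    (f : M →ₗ[UniversalEnvelopingAlgebra ℂ 𝔤] N) (m : M) : f m = 0 := by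
  have hle : ⨆ μ, (act M x).maxGenEigenspace μ ≤ LinearMap.ker (f.restrictScalars ℂ) := by
    refine iSup_le fun μ m hm => ?_
    have hfm : f m ∈ (act N x).maxGenEigenspace μ :=
      map_mem_maxGenEigenspace (f := f.restrictScalars ℂ) (fun m => (map_act f x m).symm) hm
    by_cases hμ : (act M x).HasEigenvalue μ
    · rwa [maxGenEigenspace_eq_bot (h μ hμ)] at hfm
    · rw [maxGenEigenspace_eq_bot hμ, Submodule.mem_bot] at hm
      rw [hm]
      exact zero_mem _
  exact hle ((act M x).iSup_maxGenEigenspace_eq_top ▸ Submodule.mem_top)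

end Component

section SumEquivalence

variable {𝔤 : Type u} [LieRing 𝔤] [LieAlgebra ℂ 𝔤] (B : Module.Basis (Fin 2) ℂ 𝔤)
  (hB : ⁅B 0, B 1⁆ = B 1) (𝔫 : LieSubalgebra ℂ 𝔤)
  (h𝔫 : 𝔫.toSubmodule = Submodule.span ℂ {B 1})

/-- The category `𝔚(0)_ξ` of finite-length modules, where `a = B 0` and `b = B 1`. -/
abbrev Summand (ξ : CModZ) :=
  (finBlockAt.{u, v} 𝔫 0 (B 0) (B 1) ξ).FullSubcategory

include hB h𝔫

theorem finBlock_directSum (X : DirectSumCat (Summand.{u, v} B 𝔫)) :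
    finBlock.{u, v} 𝔫 0 (ModuleCat.of _ (⨁ ξ, (X.obj ξ).obj)) := by
  have hX (ξ : CModZ) : Module.Finite ℂ (X.obj ξ).obj :=
    ((finBlockAt_iff B hB 𝔫 h𝔫 _ ξ).1 (X.obj ξ).property).1
  have : Module.Finite ℂ (⨁ ξ, (X.obj ξ).obj) := by
    refine finite_directSum (X.property.subset fun ξ hξ => ?_)
    rwa [Set.mem_ofPred_eq, isZero_fullSubcategory_iff, ModuleCat.isZero_iff_subsingleton,
      not_subsingleton_iff_nontrivial]
  rw [finBlock_iff_finite B hB 𝔫 h𝔫]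
  exact Module.Finite.of_surjective ((LinearMap.id (R := UniversalEnvelopingAlgebra ℂ 𝔤)
    (M := ⨁ ξ, (X.obj ξ).obj)).restrictScalars ℂ) Function.surjective_id

theorem exists_sum_equivalence :
    ∃ (E : DirectSumCat (Summand.{u, v} B 𝔫) ≌ (finBlock.{u, v} 𝔫 0).FullSubcategory)
      (i : ∀ ξ : CModZ,
        DirectSumCat.proj (Summand.{u, v} B 𝔫) ξ ⋙
            ObjectProperty.ιOfLE (finBlockAt_le 𝔫 0 (B 0) (B 1) ξ) ⟶ E.functor),
      ∀ M, Nonempty (IsColimit (Cofan.mk (E.functor.obj M) fun ξ => (i ξ).app M)) := by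
  classical
  have hsum := finBlock_directSum.{u, v} B hB 𝔫 h𝔫
  have : (sumFunctor.{_, v, 0} hsum).Full := sumFunctor_full hsum fun ξ η hne M N hM hN => by
    obtain ⟨_, hM⟩ := (finBlockAt_iff B hB 𝔫 h𝔫 M ξ).1 hM
    obtain ⟨-, hN⟩ := (finBlockAt_iff B hB 𝔫 h𝔫 N η).1 hN
    exact linearMap_eq_zero_of_disjoint_hasEigenvalue (x := B 0) fun μ h1 h2 =>
      hne ((hM μ h1).symm.trans (hN μ h2))
  have : (sumFunctor.{_, v, 0} hsum).EssSurj := sumFunctor_essSurj hsum fun M hM => by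
    have : Module.Finite ℂ M := (finBlock_iff_finite B hB 𝔫 h𝔫 M).1 hM
    refine ⟨isNoetherian_of_tower ℂ inferInstance, eigenComponent B hB M,
      isInternal_eigenComponent B hB, fun ξ => (finBlockAt_iff B hB 𝔫 h𝔫 _ ξ).2 ⟨?_, fun μ hμ =>
        coe_eq_of_hasEigenvalue_eigenComponent B hB hμ⟩⟩
    exact inferInstanceAs (Module.Finite ℂ ((eigenComponent B hB M ξ).restrictScalars ℂ))
  have := sumFunctor_faithful.{_, v, 0} hsum
  have : (sumFunctor.{_, v, 0} hsum).IsEquivalence := { }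
  exact ⟨(sumFunctor hsum).asEquivalence,
    sumInclusion hsum (finBlockAt_le 𝔫 0 (B 0) (B 1)), fun X => ⟨isColimitSum hsum _ X⟩⟩

end SumEquivalence

/-! ### The equivalence with modules over the quiver -/

section EnvLift

attribute [local instance] LieRing.ofAssociativeRing

variable {𝔤 : Type u} [LieRing 𝔤] [LieAlgebra ℂ 𝔤] (B : Module.Basis (Fin 2) ℂ 𝔤)
  (hB : ⁅B 0, B 1⁆ = B 1) {R : Type v} [Ring R] [Algebra ℂ R] {x y : R} (h : x * y - y * x = y)

/-- The homomorphism from the enveloping algebra that sends `a = B 0` and `b = B 1` to two given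
elements satisfying the same relation. -/
noncomputable def envLift : UniversalEnvelopingAlgebra ℂ 𝔤 →ₐ[ℂ] R :=
  UniversalEnvelopingAlgebra.lift ℂ
    { B.constr ℂ ![x, y] with
      map_lie' := by
        intro s t
        change B.constr ℂ ![x, y] ⁅s, t⁆ = ⁅B.constr ℂ ![x, y] s, B.constr ℂ ![x, y] t⁆
        have hB' : ⁅B 1, B 0⁆ = -B 1 := by rw [← lie_skew, hB]
        have hxy : ⁅x, y⁆ = y := h
        have hyx : ⁅y, x⁆ = -y := by rw [← lie_skew, hxy]
        have h0 : B.constr ℂ ![x, y] (B 0) = x := B.constr_basis ℂ _ 0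
        have h1 : B.constr ℂ ![x, y] (B 1) = y := B.constr_basis ℂ _ 1
        rw [← B.sum_repr s, ← B.sum_repr t]
        simp only [Fin.sum_univ_two, lie_add, add_lie, lie_smul, smul_lie, lie_self, hB, hB',
          map_add, map_smul, map_neg, h0, h1, hxy, hyx, smul_zero, map_zero] }

theorem envLift_ι_basis (i : Fin 2) :
    envLift B hB h (UniversalEnvelopingAlgebra.ι ℂ (B i)) = ![x, y] i :=
  (UniversalEnvelopingAlgebra.lift_ι_apply ..).trans (B.constr_basis ℂ _ i)

end EnvLift

section Total

variable {𝔤 : Type u} [LieRing 𝔤] [LieAlgebra ℂ 𝔤]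

/-- The operator `a` on the total space, with generalized eigenvalue `μ + i` at the vertex `i`. -/
noncomputable def totalA (μ : ℂ) (X : QuiverMod.{v}) : Module.End ℂ (⨁ i, X.V i) :=
  lmap fun i => X.a i + (μ + (i : ℂ)) • LinearMap.id

/-- The operator `b` on the total space. -/
noncomputable def totalB (X : QuiverMod.{v}) : Module.End ℂ (⨁ i, X.V i) :=
  toModule ℂ ℤ _ fun i => lof ℂ ℤ X.V (i + 1) ∘ₗ X.b i

theorem totalA_lof (μ : ℂ) (X : QuiverMod.{v}) (i : ℤ) (x : X.V i) :
    totalA μ X (lof ℂ ℤ X.V i x) = lof ℂ ℤ X.V i (X.a i x + (μ + (i : ℂ)) • x) :=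
  lmap_lof _ i x

theorem totalB_lof (X : QuiverMod.{v}) (i : ℤ) (x : X.V i) :
    totalB X (lof ℂ ℤ X.V i x) = lof ℂ ℤ X.V (i + 1) (X.b i x) :=
  toModule_lof ℂ i x

theorem totalA_mul_totalB_sub (μ : ℂ) (X : QuiverMod.{v}) :
    totalA μ X * totalB X - totalB X * totalA μ X = totalB X := by
  refine linearMap_ext _ fun i => LinearMap.ext fun x => ?_
  have hcomm : X.b i (X.a i x) = X.a (i + 1) (X.b i x) := LinearMap.congr_fun (X.comm i) x
  simp only [LinearMap.comp_apply, LinearMap.sub_apply, Module.End.mul_apply, totalB_lof,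
    totalA_lof, ← map_sub]
  congr 1
  rw [map_add, map_smul, hcomm]
  push_cast
  module

/-- The total space `⨁ i, V i` of a quiver module, as a `𝔤`-module: `b = B 1` acts by the arrows,
and `a = B 0` acts at the vertex `i` by the loop plus the scalar `μ + i`. -/
def Total (B : Module.Basis (Fin 2) ℂ 𝔤) (_ : ⁅B 0, B 1⁆ = B 1) (_ : ℂ) (X : QuiverMod.{v}) :
    Type v :=
  ⨁ i, X.V i

variable (B : Module.Basis (Fin 2) ℂ 𝔤) (hB : ⁅B 0, B 1⁆ = B 1) (μ : ℂ) (X : QuiverMod.{v})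

noncomputable instance : AddCommGroup (Total B hB μ X) :=
  inferInstanceAs (AddCommGroup (⨁ i, X.V i))

noncomputable instance : Module ℂ (Total B hB μ X) :=
  inferInstanceAs (Module ℂ (⨁ i, X.V i))

noncomputable instance : Module (UniversalEnvelopingAlgebra ℂ 𝔤) (Total B hB μ X) :=
  Module.compHom (⨁ i, X.V i) (envLift B hB (totalA_mul_totalB_sub μ X)).toRingHom

theorem total_smul_def (y : UniversalEnvelopingAlgebra ℂ 𝔤) (t : Total B hB μ X) :
    y • t = envLift B hB (totalA_mul_totalB_sub μ X) y t := rfl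

instance : IsScalarTower ℂ (UniversalEnvelopingAlgebra ℂ 𝔤) (Total B hB μ X) where
  smul_assoc c y t := by
    rw [total_smul_def, total_smul_def, map_smul]
    rfl

theorem act_zero_total : act (Total B hB μ X) (B 0) = totalA μ X :=
  envLift_ι_basis B hB (totalA_mul_totalB_sub μ X) 0

theorem act_one_total : act (Total B hB μ X) (B 1) = totalB X :=
  envLift_ι_basis B hB (totalA_mul_totalB_sub μ X) 1

/-- The inclusion of the space at a vertex into the total space. -/
noncomputable def totalLof (i : ℤ) : X.V i →ₗ[ℂ] Total B hB μ X := lof ℂ ℤ X.V i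

/-- The projection of the total space onto the space at a vertex. -/
noncomputable def totalComponent (i : ℤ) : Total B hB μ X →ₗ[ℂ] X.V i :=
  DirectSum.component ℂ ℤ X.V i

variable {B hB μ X}

theorem act_zero_totalLof (i : ℤ) (x : X.V i) :
    act (Total B hB μ X) (B 0) (totalLof B hB μ X i x) =
      totalLof B hB μ X i (X.a i x) + (μ + (i : ℂ)) • totalLof B hB μ X i x := by
  rw [act_zero_total, ← map_smul, ← map_add]
  exact totalA_lof μ X i x

theorem act_one_totalLof (i : ℤ) (x : X.V i) :
    act (Total B hB μ X) (B 1) (totalLof B hB μ X i x) = totalLof B hB μ X (i + 1) (X.b i x) := by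
  rw [act_one_total]
  exact totalB_lof X i x

theorem totalComponent_act_zero (i : ℤ) (t : Total B hB μ X) :
    totalComponent B hB μ X i (act (Total B hB μ X) (B 0) t) =
      X.a i (totalComponent B hB μ X i t) + (μ + (i : ℂ)) • totalComponent B hB μ X i t := by
  rw [act_zero_total]
  rfl

theorem totalLof_injective (i : ℤ) : Function.Injective (totalLof B hB μ X i) :=
  of_injective i

theorem totalLof_mem_maxGenEigenspace {i : ℤ} {x : X.V i} (hx : ∃ k : ℕ, (X.a i ^ k) x = 0) :
    totalLof B hB μ X i x ∈ (act (Total B hB μ X) (B 0)).maxGenEigenspace (μ + i) :=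
  map_mem_maxGenEigenspace_of_shift (fun x => by rw [act_zero_totalLof, sub_zero])
    (mem_maxGenEigenspace_zero.2 hx)

theorem totalComponent_eq_zero (hX : QuiverMod.finNilp X) {ν : ℂ} {t : Total B hB μ X}
    (ht : t ∈ (act (Total B hB μ X) (B 0)).maxGenEigenspace ν) {i : ℤ} (hi : μ + i ≠ ν) :
    totalComponent B hB μ X i t = 0 := by
  have hshift : totalComponent B hB μ X i t ∈
      Module.End.maxGenEigenspace (X.a i) (ν - (μ + i)) :=
    map_mem_maxGenEigenspace_of_shift
      (fun t => by rw [totalComponent_act_zero]; module) ht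
  have hdisj := (Module.End.independent_maxGenEigenspace (X.a i)).pairwiseDisjoint
    (sub_ne_zero.2 hi.symm)
  exact Submodule.disjoint_def.1 hdisj _ hshift (mem_maxGenEigenspace_zero.2 (hX.2 i _))

theorem exists_add_intCast_eq_of_hasEigenvalue_total (hX : QuiverMod.finNilp X) {ν : ℂ}
    (hν : (act (Total B hB μ X) (B 0)).HasEigenvalue ν) : ∃ i : ℤ, μ + i = ν := by
  by_contra! h
  obtain ⟨t, ht⟩ := hν.exists_hasEigenvector
  exact ht.2 (DFinsupp.ext fun i => totalComponent_eq_zero hX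
    (Module.End.eigenspace_le_maxGenEigenspace ht.1) (h i))

theorem finite_total (hX : QuiverMod.finNilp X) : Module.Finite ℂ (Total B hB μ X) :=
  have := hX.1.1
  finite_directSum hX.1.2

section Desc

variable {N : Type w} [AddCommGroup N] [Module ℂ N] [Module (UniversalEnvelopingAlgebra ℂ 𝔤) N]
  [IsScalarTower ℂ (UniversalEnvelopingAlgebra ℂ 𝔤) N]

theorem total_hom_ext {f g : Total B hB μ X →ₗ[UniversalEnvelopingAlgebra ℂ 𝔤] N}
    (h : ∀ i x, f (totalLof B hB μ X i x) = g (totalLof B hB μ X i x)) : f = g := by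
  have hfg : f.restrictScalars ℂ = g.restrictScalars ℂ :=
    linearMap_ext _ fun i => LinearMap.ext (h i)
  exact LinearMap.ext fun t => LinearMap.congr_fun hfg t

variable (f : ∀ i, X.V i →ₗ[ℂ] N)
  (ha : ∀ i x, f i (X.a i x) + (μ + (i : ℂ)) • f i x = act N (B 0) (f i x))
  (hb : ∀ i x, f (i + 1) (X.b i x) = act N (B 1) (f i x))

/-- The homomorphism from the total space given by maps on the spaces at the vertices. -/
noncomputable def totalDesc : Total B hB μ X →ₗ[UniversalEnvelopingAlgebra ℂ 𝔤] N :=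
  let F : Total B hB μ X →ₗ[ℂ] N := toModule ℂ ℤ N f
  have hF (i x) : F (totalLof B hB μ X i x) = f i x := toModule_lof ℂ i x
  linearMapOfCommute B F <| Fin.forall_fin_two.2
    ⟨LinearMap.congr_fun (f := F ∘ₗ act _ (B 0)) (g := act _ (B 0) ∘ₗ F) <|
      linearMap_ext _ fun i => LinearMap.ext fun x => by
        change F (act _ (B 0) (totalLof B hB μ X i x)) = act _ (B 0) (F (totalLof B hB μ X i x))
        rw [act_zero_totalLof, map_add, map_smul, hF, hF, ha],
    LinearMap.congr_fun (f := F ∘ₗ act _ (B 1)) (g := act _ (B 1) ∘ₗ F) <|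
      linearMap_ext _ fun i => LinearMap.ext fun x => by
        change F (act _ (B 1) (totalLof B hB μ X i x)) = act _ (B 1) (F (totalLof B hB μ X i x))
        rw [act_one_totalLof, hF, hF, hb]⟩

theorem totalDesc_totalLof (i : ℤ) (x : X.V i) :
    totalDesc (hB := hB) f ha hb (totalLof B hB μ X i x) = f i x :=
  toModule_lof ℂ i x

end Desc

section Map

variable {Y : QuiverMod.{v}}

variable (B hB μ) in
/-- The homomorphism of total spaces induced by a morphism of quiver modules. -/
noncomputable def totalMap (f : X ⟶ Y) :
    Total B hB μ X →ₗ[UniversalEnvelopingAlgebra ℂ 𝔤] Total B hB μ Y :=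
  totalDesc (fun i => totalLof B hB μ Y i ∘ₗ f.1 i)
    (fun i x => by
      have hf : f.1 i (X.a i x) = Y.a i (f.1 i x) := LinearMap.congr_fun (f.2.1 i) x
      rw [LinearMap.comp_apply, LinearMap.comp_apply, act_zero_totalLof, hf])
    (fun i x => by
      have hf : f.1 (i + 1) (X.b i x) = Y.b i (f.1 i x) := LinearMap.congr_fun (f.2.2 i) x
      rw [LinearMap.comp_apply, LinearMap.comp_apply, act_one_totalLof, hf])

theorem totalMap_totalLof (f : X ⟶ Y) (i : ℤ) (x : X.V i) :
    totalMap B hB μ f (totalLof B hB μ X i x) = totalLof B hB μ Y i (f.1 i x) :=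
  totalDesc_totalLof ..

theorem totalMap_injective : Function.Injective (totalMap B hB μ (X := X) (Y := Y)) :=
  fun f g h => Subtype.ext <| funext fun i => LinearMap.ext fun x => totalLof_injective i <|
    (totalMap_totalLof f i x).symm.trans ((LinearMap.congr_fun h _).trans (totalMap_totalLof g i x))

-- The spaces at the vertices are generalized eigenspaces of `a`, so homomorphisms preserve them.
theorem totalMap_surjective (hX : QuiverMod.finNilp X) (hY : QuiverMod.finNilp Y) :
    Function.Surjective (totalMap B hB μ (X := X) (Y := Y)) := by
  intro g
  let f (i) : X.V i →ₗ[ℂ] Y.V i :=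
    totalComponent B hB μ Y i ∘ₗ g.restrictScalars ℂ ∘ₗ totalLof B hB μ X i
  have hg (i x) : g (totalLof B hB μ X i x) = totalLof B hB μ Y i (f i x) := by
    refine directSum_eq_lof (R := ℂ) fun j hj => totalComponent_eq_zero hY
      (map_mem_maxGenEigenspace (f := g.restrictScalars ℂ) (fun t => (map_act g (B 0) t).symm)
        (totalLof_mem_maxGenEigenspace (hX.2 i x))) fun h => hj ?_
    exact Int.cast_injective (add_left_cancel h)
  refine ⟨⟨f, fun i => LinearMap.ext fun x => ?_, fun i => LinearMap.ext fun x => ?_⟩,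
    total_hom_ext fun i x => (totalMap_totalLof _ i x).trans (hg i x).symm⟩
  · have hact := map_act g (B 0) (totalLof B hB μ X i x)
    rw [act_zero_totalLof, map_add, LinearMap.map_smul_of_tower, hg, hg, act_zero_totalLof] at hact
    exact totalLof_injective i (add_right_cancel hact)
  · have hact := map_act g (B 1) (totalLof B hB μ X i x)
    rw [act_one_totalLof, hg, hg, act_one_totalLof] at hact
    exact totalLof_injective (i + 1) hact

end Map

end Total

theorem coe_eq_coe_iff {μ ν : ℂ} : (ν : CModZ) = (μ : CModZ) ↔ ∃ i : ℤ, μ + i = ν := by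
  rw [eq_comm, QuotientAddGroup.eq, AddSubgroup.mem_zmultiples_iff]
  simp only [zsmul_one, eq_neg_add_iff_add_eq]

section EigenQuiver

variable {𝔤 : Type u} [LieRing 𝔤] [LieAlgebra ℂ 𝔤] (B : Module.Basis (Fin 2) ℂ 𝔤)
  (hB : ⁅B 0, B 1⁆ = B 1) (μ : ℂ)
variable (M : Type v) [AddCommGroup M] [Module ℂ M] [Module (UniversalEnvelopingAlgebra ℂ 𝔤) M]
  [IsScalarTower ℂ (UniversalEnvelopingAlgebra ℂ 𝔤) M]

/-- The quiver module with the generalized eigenspace of `a = B 0` for `μ + i` at the vertex `i`,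
with loops `a - (μ + i)` and arrows `b = B 1`. -/
noncomputable def eigenQuiver : QuiverMod.{v} where
  V i := (act M (B 0)).maxGenEigenspace (μ + (i : ℂ))
  a i := (act M (B 0) - (μ + (i : ℂ)) • (1 : Module.End ℂ M)).restrict fun m hm =>
    Submodule.sub_mem _ (map_mem_maxGenEigenspace (fun _ => rfl) hm) (Submodule.smul_mem _ _ hm)
  b i := (act M (B 1)).restrict fun m hm => by
    rw [Int.cast_add, Int.cast_one, ← add_assoc]
    exact act_mem_maxGenEigenspace_add_one hB hm
  comm i := by
    refine LinearMap.ext fun x => Subtype.ext ?_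
    change act M (B 1) (act M (B 0) x - (μ + (i : ℂ)) • (x : M)) =
      act M (B 0) (act M (B 1) x) - (μ + ((i + 1 : ℤ) : ℂ)) • act M (B 1) x
    rw [act_act hB, map_sub, map_smul]
    push_cast
    module

variable {B M} in
theorem iSupIndep_maxGenEigenspace_add_intCast (f : Module.End ℂ M) :
    iSupIndep fun i : ℤ => f.maxGenEigenspace (μ + (i : ℂ)) :=
  f.independent_maxGenEigenspace.comp fun _ _ h => Int.cast_injective (add_left_cancel h)

theorem eigenQuiver_finNilp [Module.Finite ℂ M] : QuiverMod.finNilp (eigenQuiver B hB μ M) := by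
  refine ⟨⟨fun i => ?_, ?_⟩, fun i x => ?_⟩
  · exact inferInstanceAs (Module.Finite ℂ ((act M (B 0)).maxGenEigenspace (μ + (i : ℂ))))
  · refine (WellFoundedGT.finite_ne_bot_of_iSupIndep
      (iSupIndep_maxGenEigenspace_add_intCast μ (act M (B 0)))).subset fun i hi => ?_
    exact (Submodule.nontrivial_iff_ne_bot).1 hi
  · have hx : x.1 ∈ (act M (B 0) - (μ + (i : ℂ)) • 1).maxGenEigenspace 0 :=
      mem_maxGenEigenspace_zero.2 ((Module.End.mem_maxGenEigenspace _ _ _).1 x.2)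
    exact mem_maxGenEigenspace_zero.1 <| (map_mem_maxGenEigenspace_iff
      (f := ((act M (B 0)).maxGenEigenspace (μ + (i : ℂ))).subtype)
      (A := (eigenQuiver B hB μ M).a i) (Submodule.injective_subtype _) fun _ => rfl).1 hx

/-- The homomorphism to a module from the total space of its generalized eigenspaces. -/
noncomputable def eigenSum :
    Total B hB μ (eigenQuiver B hB μ M) →ₗ[UniversalEnvelopingAlgebra ℂ 𝔤] M :=
  totalDesc (fun i => ((act M (B 0)).maxGenEigenspace (μ + (i : ℂ))).subtype)
    (fun _ _ => sub_add_cancel _ _) fun _ _ => rfl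

theorem eigenSum_bijective [Module.Finite ℂ M]
    (h : ∀ ν : ℂ, (act M (B 0)).HasEigenvalue ν → (ν : CModZ) = (μ : CModZ)) :
    Function.Bijective (eigenSum B hB μ M) := by
  have htop : ⨆ i : ℤ, (act M (B 0)).maxGenEigenspace (μ + (i : ℂ)) = ⊤ := by
    rw [← iSup_maxGenEigenspace_eq_top_of_forall_mem (s := Set.range fun i : ℤ => μ + (i : ℂ))
      fun ν hν => coe_eq_coe_iff.1 (h ν hν), iSup_range]
  exact isInternal_submodule_of_iSupIndep_of_iSup_eq_top
    (iSupIndep_maxGenEigenspace_add_intCast μ _) htop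

end EigenQuiver

section QuiverEquivalence

variable {𝔤 : Type u} [LieRing 𝔤] [LieAlgebra ℂ 𝔤] (B : Module.Basis (Fin 2) ℂ 𝔤)
  (hB : ⁅B 0, B 1⁆ = B 1) (𝔫 : LieSubalgebra ℂ 𝔤)
  (h𝔫 : 𝔫.toSubmodule = Submodule.span ℂ {B 1})

include hB h𝔫 in
theorem finBlockAt_of_iff (T : Type v) [AddCommGroup T] [inst : Module ℂ T]
    [Module (UniversalEnvelopingAlgebra ℂ 𝔤) T]
    [IsScalarTower ℂ (UniversalEnvelopingAlgebra ℂ 𝔤) T] (ξ : CModZ) :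
    finBlockAt.{u, v} 𝔫 0 (B 0) (B 1) ξ (ModuleCat.of (UniversalEnvelopingAlgebra ℂ 𝔤) T) ↔
      Module.Finite ℂ T ∧ ∀ ν : ℂ, (act T (B 0)).HasEigenvalue ν → (ν : CModZ) = ξ := by
  obtain rfl : inst = Module.restrictScalars ℂ (UniversalEnvelopingAlgebra ℂ 𝔤) T :=
    Module.ext' _ _ fun c m => (algebraMap_smul (UniversalEnvelopingAlgebra ℂ 𝔤) c m).symm
  exact finBlockAt_iff B hB 𝔫 h𝔫 _ ξ

include hB h𝔫 in
theorem finBlockAt_total (μ : ℂ) {X : QuiverMod.{v}} (hX : QuiverMod.finNilp X) :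
    finBlockAt.{u, v} 𝔫 0 (B 0) (B 1) (μ : CModZ) (ModuleCat.of _ (Total B hB μ X)) := by
  rw [finBlockAt_of_iff B hB 𝔫 h𝔫]
  exact ⟨finite_total hX, fun ν hν =>
    coe_eq_coe_iff.2 (exists_add_intCast_eq_of_hasEigenvalue_total hX hν)⟩

/-- The functor that sends a quiver module to its total space. -/
noncomputable def totalFunctor (μ : ℂ) :
    (QuiverMod.finNilp.{v}).FullSubcategory ⥤ Summand.{u, v} B 𝔫 (μ : CModZ) where
  obj X := ⟨ModuleCat.of _ (Total B hB μ X.obj), finBlockAt_total B hB 𝔫 h𝔫 μ X.property⟩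
  map f := ObjectProperty.homMk (ModuleCat.ofHom (totalMap B hB μ f.hom))
  map_id _ := ObjectProperty.hom_ext _ <| ModuleCat.hom_ext <| total_hom_ext fun i x =>
    totalMap_totalLof _ i x
  map_comp f g := ObjectProperty.hom_ext _ <| ModuleCat.hom_ext <| total_hom_ext fun i x =>
    (totalMap_totalLof (f.hom ≫ g.hom) i x).trans <|
      ((congrArg (totalMap B hB μ g.hom) (totalMap_totalLof f.hom i x)).trans
        (totalMap_totalLof g.hom i _)).symm

theorem totalFunctor_faithful (μ : ℂ) : (totalFunctor.{u, v} B hB 𝔫 h𝔫 μ).Faithful where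
  map_injective h := ObjectProperty.hom_ext _ <| totalMap_injective <|
    congrArg (fun g => g.hom.hom) h

theorem totalFunctor_full (μ : ℂ) : (totalFunctor.{u, v} B hB 𝔫 h𝔫 μ).Full where
  map_surjective {X Y} g :=
    (totalMap_surjective X.property Y.property g.hom.hom).imp' ObjectProperty.homMk fun _ hf =>
      ObjectProperty.hom_ext _ (ModuleCat.hom_ext hf)

theorem totalFunctor_essSurj (μ : ℂ) : (totalFunctor.{u, v} B hB 𝔫 h𝔫 μ).EssSurj where
  mem_essImage M := by
    obtain ⟨_, heigen⟩ := (finBlockAt_iff B hB 𝔫 h𝔫 _ _).1 M.property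
    exact ⟨⟨eigenQuiver B hB μ M.obj, eigenQuiver_finNilp B hB μ M.obj⟩,
      ⟨ObjectProperty.isoMk _ (LinearEquiv.ofBijective (eigenSum B hB μ M.obj)
        (eigenSum_bijective B hB μ M.obj heigen)).toModuleIso⟩⟩

theorem totalFunctor_additive (μ : ℂ) : (totalFunctor.{u, v} B hB 𝔫 h𝔫 μ).Additive where
  map_add {X Y f g} := by
    refine ObjectProperty.hom_ext _ <| ModuleCat.hom_ext <| total_hom_ext fun i x => ?_
    change totalMap B hB μ (f + g).hom _ = totalMap B hB μ f.hom _ + totalMap B hB μ g.hom _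
    rw [totalMap_totalLof, totalMap_totalLof, totalMap_totalLof, ← map_add]
    rfl

theorem totalFunctor_linear (μ : ℂ) : (totalFunctor.{u, v} B hB 𝔫 h𝔫 μ).Linear ℂ where
  map_smul {X Y} f c := by
    refine ObjectProperty.hom_ext _ <| ModuleCat.hom_ext <| total_hom_ext fun i x => ?_
    change totalMap B hB μ (c • f).hom _ =
      algebraMap ℂ (UniversalEnvelopingAlgebra ℂ 𝔤) c • totalMap B hB μ f.hom _
    rw [totalMap_totalLof, totalMap_totalLof, algebraMap_smul, ← map_smul]
    rfl

include hB h𝔫 in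
theorem exists_quiver_equivalence (ξ : CModZ) :
    ∃ e : Summand.{u, v} B 𝔫 ξ ≌ (QuiverMod.finNilp.{v}).FullSubcategory,
      e.functor.Additive ∧ e.functor.Linear ℂ := by
  obtain ⟨μ, rfl⟩ := QuotientAddGroup.mk_surjective ξ
  have := totalFunctor_faithful.{u, v} B hB 𝔫 h𝔫 μ
  have := totalFunctor_full.{u, v} B hB 𝔫 h𝔫 μ
  have := totalFunctor_essSurj.{u, v} B hB 𝔫 h𝔫 μ
  have : (totalFunctor.{u, v} B hB 𝔫 h𝔫 μ).IsEquivalence := { }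
  let e := (totalFunctor.{u, v} B hB 𝔫 h𝔫 μ).asEquivalence
  have : e.functor.Additive := totalFunctor_additive.{u, v} B hB 𝔫 h𝔫 μ
  have : e.functor.Linear ℂ := totalFunctor_linear.{u, v} B hB 𝔫 h𝔫 μ
  exact ⟨e.symm, e.inverse_additive, e.inverseLinear ℂ⟩

end QuiverEquivalence

end Whittaker

open Whittaker in
theorem theorem6003 {𝔤 : Type u} [LieRing 𝔤] [LieAlgebra ℂ 𝔤]
    (B : Module.Basis (Fin 2) ℂ 𝔤) (hB : ⁅B 0, B 1⁆ = B 1)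
    (𝔫 : LieSubalgebra ℂ 𝔤) (h𝔫 : 𝔫.toSubmodule = Submodule.span ℂ {B 1}) :
    (∃ (E : DirectSumCat
            (fun ξ : CModZ => (finBlockAt.{u, v} 𝔫 0 (B 0) (B 1) ξ).FullSubcategory) ≌
          (finBlock.{u, v} 𝔫 0).FullSubcategory)
        (i : ∀ ξ : CModZ,
          DirectSumCat.proj
              (fun ξ : CModZ => (finBlockAt.{u, v} 𝔫 0 (B 0) (B 1) ξ).FullSubcategory) ξ ⋙
            ObjectProperty.ιOfLE (finBlockAt_le 𝔫 0 (B 0) (B 1) ξ) ⟶ E.functor),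
        ∀ M, Nonempty (IsColimit (Cofan.mk (E.functor.obj M) fun ξ => (i ξ).app M))) ∧
    ∀ ξ : CModZ,
      ∃ e : (finBlockAt.{u, v} 𝔫 0 (B 0) (B 1) ξ).FullSubcategory ≌
          (QuiverMod.finNilp.{v}).FullSubcategory,
        e.functor.Additive ∧ e.functor.Linear ℂ :=
  ⟨exists_sum_equivalence B hB 𝔫 h𝔫, exists_quiver_equivalence B hB 𝔫 h𝔫⟩
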